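/- Let $D\ge 1$ and let $\Sigma\in\mathbb R^{D\times D}$ be symmetric positive definite with $\operatorname{tr}\Sigma=D$. The loss of a probability law $q$ on $\mathbb R^D$ is $\mathcal L(q)=\mathrm{KL}(q\,\|\,\mathcal N(0,I))$. An iteratively trained Gaussianization block with rotation $Q\in O(D)$ maps a law $\mu$ to the law of $f(Qx)$, $x\sim\mu$, where $f(y)=(f_1(y_1),\dots,f_D(y_D))$, with $f_i$ increasing bijections of $\mathbb R$, minimizes the loss of the resulting law among all such dimension-wise maps. Let $\mathcal L=\mathcal L(\mathcal N(0,\Sigma))$, and let $\mathcal L^{(n)}$ be the loss of the law obtained from $\mathcal N(0,\Sigma)$ by $n$ successively trained blocks with independent Haar-random rotations $Q_1,\dots,Q_n\in O(D)$. Then the following hold. (0) $\mathcal L^{(n)}$ is finite for all rotations and integrable. (1) For every $n\ge 0$ and $\varepsilon>0$ there is $\delta>0$, independent of $D$ and $\Sigma$, such that $\mathcal L\le\delta$ implies $$\Big|\mathbb E[\mathcal L^{(n)}]-\Big(1-\frac{2}{D+2}\Big)^n\mathcal L\Big|\le\varepsilon\Big(1-\frac{2}{D+2}\Big)^n\mathcal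 L .$$ (2) For every $\varepsilon\in(0,1)$ there is $\delta>0$, independent of $D$ and $\Sigma$, such that $\mathcal L\le\delta$ implies, for all $n\ge 0$, $$\Big(1-\frac{2(1+\varepsilon)}{D+2}\Big)^n\mathcal L\le\mathbb E[\mathcal L^{(n)}]\le\Big(1-\frac{2(1-\varepsilon)}{D+2}\Big)^n\mathcal L .$$ (3) For every such $\Sigma$, whatever the size of $\mathcal L$, with $g=e^{-2\mathcal L/D}$ and $\kappa=\frac{1+\sqrt{1-g^D}}{1-\sqrt{1-g^D}}$, $$\mathbb E[\mathcal L^{(1)}]\ge\mathcal L-\frac{2}{D+2}\,\kappa^2\,\frac D2(1-g).$$ (4) For every $\varepsilon\in(0,1)$ there is $\delta>0$, independent of $D$ and $\Sigma$, such that if $0<\mathcal L\le\delta$, then for all $n\ge 0$ and $\mathcal L'>0$, $\mathbb E[\mathcal L^{(n)}]\le\mathcal L'$ implies $$n\ge(1-\varepsilon)\,\frac{\log(\mathcal L'/\mathcal L)}{\log\big(1-\frac{2}{D+2}\big)} .$$ (5) The number of blocks needed to cut the loss by a fixed factor is $\Omega(D)$: for every $r\in(0,1)$ there are $\delta,c>0$,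 independent of $D$ and $\Sigma$, such that if $0<\mathcal L\le\delta$ and $\mathbb E[\mathcal L^{(n)}]\le r\mathcal L$, then $n\ge cD$. -/

import Mathlib

open MeasureTheory ProbabilityTheory InformationTheory
open scoped ENNReal

namespace Gaussianization

/-- The orthogonal group `O(D)` of real orthogonal `D × D` matrices, with the subspace topology. -/
abbrev OD (D : ℕ) : Type := Matrix.orthogonalGroup (Fin D) ℝ

/-- The Borel σ-algebra of `O(D)`. -/
instance instMeasurableSpaceOD (D : ℕ) : MeasurableSpace (OD D) := borel (OD D)

instance instBorelSpaceOD (D : ℕ) : BorelSpace (OD D) := ⟨rfl⟩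

theorem isCompact_orthogonalGroup (D : ℕ) :
    IsCompact (Matrix.orthogonalGroup (Fin D) ℝ : Set (Matrix (Fin D) (Fin D) ℝ)) := by
  have hK : IsCompact (Set.pi Set.univ fun _ : Fin D =>
      Set.pi Set.univ fun _ : Fin D => Set.Icc (-1 : ℝ) 1) :=
    isCompact_univ_pi fun _ => isCompact_univ_pi fun _ => isCompact_Icc
  refine IsCompact.of_isClosed_subset hK ?_ ?_
  · have h : (Matrix.orthogonalGroup (Fin D) ℝ : Set (Matrix (Fin D) (Fin D) ℝ)) =
        {A : Matrix (Fin D) (Fin D) ℝ | A * star A = 1} := by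
      ext A
      exact Matrix.mem_unitaryGroup_iff
    rw [h]
    exact isClosed_eq (by fun_prop) continuous_const
  · intro A hA i _ j _
    have h := entry_norm_bound_of_unitary (𝕜 := ℝ) hA i j
    rw [Real.norm_eq_abs] at h
    exact abs_le.mp h

instance instCompactSpaceOD (D : ℕ) : CompactSpace (OD D) :=
  isCompact_iff_compactSpace.mp (isCompact_orthogonalGroup D)

/-- The Haar probability measure on `O(D)`: the law of a uniformly random rotation. -/
noncomputable def haarOD (D : ℕ) : Measure (OD D) :=
  Measure.haarMeasure (⊤ : TopologicalSpace.PositiveCompacts (OD D))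

instance instIsProbabilityMeasureHaarOD (D : ℕ) : IsProbabilityMeasure (haarOD D) :=
  ⟨by
    have h := Measure.haarMeasure_self (K₀ := (⊤ : TopologicalSpace.PositiveCompacts (OD D)))
    rwa [TopologicalSpace.PositiveCompacts.coe_top] at h⟩

/-- The rotation layer `x ↦ Q x`. -/
noncomputable def rot {D : ℕ} (Q : OD D) (x : EuclideanSpace ℝ (Fin D)) :
    EuclideanSpace ℝ (Fin D) :=
  Matrix.toEuclideanCLM (n := Fin D) (𝕜 := ℝ) (Q : Matrix (Fin D) (Fin D) ℝ) x

/-- The dimension-wise layer `(x₁, …, x_D) ↦ (T₁ x₁, …, T_D x_D)`. Each `T i` is an increasing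
(hence bicontinuous) bijection of the real line. -/
def dimwise {D : ℕ} (T : Fin D → (ℝ ≃o ℝ)) (x : EuclideanSpace ℝ (Fin D)) :
    EuclideanSpace ℝ (Fin D) :=
  WithLp.toLp 2 fun i => T i (x i)

/-- The loss of a latent law `q`: the Kullback-Leibler divergence `KL(q ‖ N(0, I))`. -/
noncomputable def loss {D : ℕ} (q : Measure (EuclideanSpace ℝ (Fin D))) : ℝ≥0∞ :=
  klDiv q (stdGaussian (EuclideanSpace ℝ (Fin D)))

/-- `T` is a result of training the dimension-wise layer on data of law `ν`: it minimizes the loss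
among all dimension-wise layers. -/
def IsTrained {D : ℕ} (ν : Measure (EuclideanSpace ℝ (Fin D))) (T : Fin D → (ℝ ≃o ℝ)) : Prop :=
  ∀ T' : Fin D → (ℝ ≃o ℝ), loss (ν.map (dimwise T)) ≤ loss (ν.map (dimwise T'))

open Classical in
/-- A dimension-wise layer trained on data of law `ν` (the identity if there is no minimizer). -/
noncomputable def trainedLayer {D : ℕ} (ν : Measure (EuclideanSpace ℝ (Fin D))) :
    Fin D → (ℝ ≃o ℝ) :=
  if h : ∃ T, IsTrained ν T then h.choose else fun _ => OrderIso.refl ℝ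

/-- The action of a trained Gaussianization block with rotation `Q` on data of law `μ`:
the data is rotated by `Q`, and the dimension-wise layer is trained on the rotated data. -/
noncomputable def block {D : ℕ} (Q : OD D) (μ : Measure (EuclideanSpace ℝ (Fin D))) :
    Measure (EuclideanSpace ℝ (Fin D)) :=
  (μ.map (rot Q)).map (dimwise (trainedLayer (μ.map (rot Q))))

/-- The latent law after `n` iteratively trained blocks with rotations `Q 0, …, Q (n - 1)`, for data
of law `μ`: each block is trained on the output of the blocks before it. -/
noncomputable def latent {D : ℕ} : (n : ℕ) → (Fin n → OD D) →
    Measure (EuclideanSpace ℝ (Fin D)) → Measure (EuclideanSpace ℝ (Fin D))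
  | 0, _, μ => μ
  | n + 1, Q, μ => latent n (fun k => Q k.succ) (block (Q 0) μ)

/-- The joint law of `n` independent Haar-random rotations. -/
noncomputable def haarRotations (D n : ℕ) : Measure (Fin n → OD D) :=
  Measure.pi fun _ => haarOD D

/-- The data law `N(0, Σ)`. -/
noncomputable def gaussianData {D : ℕ} (S : Matrix (Fin D) (Fin D) ℝ) :
    Measure (EuclideanSpace ℝ (Fin D)) :=
  multivariateGaussian 0 S

/-- The initial loss `KL(N(0, Σ) ‖ N(0, I))`. -/
noncomputable def initialLoss {D : ℕ} (S : Matrix (Fin D) (Fin D) ℝ) : ℝ :=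
  (loss (gaussianData S)).toReal

/-- The loss for data of law `N(0, Σ)` after `n` iteratively trained blocks with rotations `Q`. -/
noncomputable def lossAfter {D : ℕ} (S : Matrix (Fin D) (Fin D) ℝ) (n : ℕ) (Q : Fin n → OD D) : ℝ :=
  (loss (latent n Q (gaussianData S))).toReal

/-- The expected loss after `n` iteratively trained blocks with independent Haar-random
rotations. -/
noncomputable def expectedLoss {D : ℕ} (S : Matrix (Fin D) (Fin D) ℝ) (n : ℕ) : ℝ :=
  ∫ Q, lossAfter S n Q ∂(haarRotations D n)

/-- Admissible covariance matrices: (symmetric) positive definite, normalized to trace `D`. -/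
def IsNormalizedCov {D : ℕ} (S : Matrix (Fin D) (Fin D) ℝ) : Prop :=
  S.PosDef ∧ S.trace = D

/-- The loss reduction factor per block, `1 - 2 / (D + 2)`. -/
noncomputable def rate (D : ℕ) : ℝ := 1 - 2 / ((D : ℝ) + 2)

/-- The geometric mean of the eigenvalues of a covariance matrix of trace `D` and loss `l`. -/
noncomputable def geomMean (D : ℕ) (l : ℝ) : ℝ := Real.exp (-2 * l / D)

/-- The largest condition number that eigenvalues with mean `1` and geometric mean `g` can have. -/
noncomputable def condBound (D : ℕ) (g : ℝ) : ℝ :=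
  (1 + Real.sqrt (1 - g ^ D)) / (1 - Real.sqrt (1 - g ^ D))

end Gaussianization

/-! A trained block keeps Gaussian data Gaussian. For any product reference, the divergence is the
divergence to the product of the marginals plus the divergences of the marginals
(`toReal_klDiv_pi_eq_add`). Hence data with standard normal marginals cannot be improved
coordinatewise, and the optimal layer is the standardization of the coordinates
(`trainedLayer_gaussianData`). So a block replaces `S` by the correlation matrix of `Q S Qᵀ`.

At trace `D` the loss is `-log det S / 2 = ½ ∑ h(v j)`, with `v` the eigenvalues and `h t = t - 1 -
log t`. One block lowers it by `½ ∑ h(a i)`, with `a` the diagonal of `Q S Qᵀ`. All `v j` and `a i`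
lie in `[m, M]`, where `m ≤ 1 ≤ M` are the extreme eigenvalues, and there `h` lies between `(t - 1)²
/ (2M)` and `(t - 1)² / (2m)`. Fourth moments of Haar rows give `E ∑ (a i - 1)² = 2 / (D + 2) * ∑ (v
j - 1)²`. The expected relative gain is therefore `2 / (D + 2)` up to a factor `M / m`
(`exists_step_bounds`).

The loss alone bounds `M / m`, by a quantity free of `D` that tends to `1` with the loss
(`le_lossCondBound_mul`). Since no block increases the loss, the one-step estimate can be iterated
with the same constant. The bounds on the number of blocks follow by taking logarithms. -/

namespace Gaussianization

/-! ### Kullback-Leibler divergence to product measures. -/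

section KullbackLeibler

variable {α β ι : Type*} [MeasurableSpace α] [MeasurableSpace β] [Fintype ι]

theorem klDiv_map_measurableEquiv (e : α ≃ᵐ β) (μ ν : Measure α) [IsFiniteMeasure μ]
    [IsFiniteMeasure ν] : klDiv (μ.map e) (ν.map e) = klDiv μ ν := by
  refine le_antisymm (klDiv_map_le _ _ e.measurable) ?_
  have h := klDiv_map_le (μ.map e) (ν.map e) e.symm.measurable
  rwa [Measure.map_map e.symm.measurable e.measurable,
    Measure.map_map e.symm.measurable e.measurable, MeasurableEquiv.symm_comp_self,
    Measure.map_id, Measure.map_id] at h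

/-- It suffices to compare boxes; there the integrand is a product of functions of independent
coordinates, so the integral factors. -/
theorem pi_eq_withDensity_prod_rnDeriv (μ η : ι → Measure ℝ) [∀ i, IsProbabilityMeasure (μ i)]
    [∀ i, IsProbabilityMeasure (η i)] (h : ∀ i, μ i ≪ η i) :
    Measure.pi μ = (Measure.pi η).withDensity fun x => ∏ i, (μ i).rnDeriv (η i) (x i) := by
  refine Measure.pi_eq (μ := μ) fun s hs => ?_
  rw [withDensity_apply _ (MeasurableSet.univ_pi hs), ← lintegral_indicator (.univ_pi hs)]
  have hind : ∀ x : ι → ℝ, (Set.univ.pi s).indicator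
      (fun x => ∏ i, (μ i).rnDeriv (η i) (x i)) x =
        ∏ i, (s i).indicator ((μ i).rnDeriv (η i)) (x i) := by
    intro x
    by_cases hx : x ∈ Set.univ.pi s
    · rw [Set.indicator_of_mem hx]
      exact Finset.prod_congr rfl fun i _ => (Set.indicator_of_mem (hx i trivial) _).symm
    · rw [Set.indicator_of_notMem hx]
      obtain ⟨i, hi⟩ : ∃ i, x i ∉ s i := by simpa [Set.mem_pi] using hx
      exact (Finset.prod_eq_zero (Finset.mem_univ i) (Set.indicator_of_notMem hi _)).symm
  have hm : ∀ i, Measurable ((s i).indicator ((μ i).rnDeriv (η i))) := fun i =>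
    (Measure.measurable_rnDeriv _ _).indicator (hs i)
  simp_rw [hind]
  rw [lintegral_prod_eq_prod_lintegral_of_indepFun Finset.univ
    (fun i (x : ι → ℝ) => (s i).indicator ((μ i).rnDeriv (η i)) (x i))
    (iIndepFun_pi fun i => (hm i).aemeasurable)
    (fun i => (hm i).comp (measurable_pi_apply i))]
  refine Finset.prod_congr rfl fun i _ => ?_
  rw [(measurePreserving_eval η i).lintegral_comp (hm i), lintegral_indicator (hs i),
    Measure.setLIntegral_rnDeriv (h i)]

theorem pi_absolutelyContinuous (μ η : ι → Measure ℝ) [∀ i, IsProbabilityMeasure (μ i)]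
    [∀ i, IsProbabilityMeasure (η i)] (h : ∀ i, μ i ≪ η i) : Measure.pi μ ≪ Measure.pi η := by
  rw [pi_eq_withDensity_prod_rnDeriv μ η h]
  exact withDensity_absolutelyContinuous _ _

theorem llr_pi (μ η : ι → Measure ℝ) [∀ i, IsProbabilityMeasure (μ i)]
    [∀ i, IsProbabilityMeasure (η i)] (h : ∀ i, μ i ≪ η i) :
    ∀ᵐ x ∂Measure.pi μ, llr (Measure.pi μ) (Measure.pi η) x = ∑ i, llr (μ i) (η i) (x i) := by
  have h1 : ∀ᵐ x ∂Measure.pi μ,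
      (Measure.pi μ).rnDeriv (Measure.pi η) x = ∏ i, (μ i).rnDeriv (η i) (x i) := by
    refine (pi_absolutelyContinuous μ η h).ae_le ?_
    rw [pi_eq_withDensity_prod_rnDeriv μ η h]
    exact Measure.rnDeriv_withDensity _ (Finset.measurable_prod _ fun i _ =>
      (Measure.measurable_rnDeriv _ _).comp (measurable_pi_apply i))
  have h2 : ∀ᵐ x ∂Measure.pi μ, ∀ i, 0 < (μ i).rnDeriv (η i) (x i) :=
    ae_all_iff.2 fun i => (measurePreserving_eval μ i).quasiMeasurePreserving.ae
      (Measure.rnDeriv_pos (h i))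
  have h3 : ∀ᵐ x ∂Measure.pi μ, ∀ i, (μ i).rnDeriv (η i) (x i) < ∞ :=
    ae_all_iff.2 fun i => (measurePreserving_eval μ i).quasiMeasurePreserving.ae
      ((h i).ae_le (Measure.rnDeriv_lt_top _ _))
  filter_upwards [h1, h2, h3] with x hx1 hx2 hx3
  simp only [llr]
  rw [hx1, ENNReal.toReal_prod, Real.log_prod]
  exact fun i _ => (ENNReal.toReal_pos (hx2 i).ne' (hx3 i).ne).ne'

theorem llr_add_llr {μ ν κ : Measure α} [SigmaFinite μ] [SigmaFinite ν] [SigmaFinite κ]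
    (h₁ : μ ≪ ν) (h₂ : ν ≪ κ) : ∀ᵐ x ∂μ, llr μ κ x = llr μ ν x + llr ν κ x := by
  have e := (h₁.trans h₂).ae_le (Measure.rnDeriv_mul_rnDeriv (κ := κ) h₁)
  filter_upwards [e, Measure.rnDeriv_pos h₁, h₁.ae_le (Measure.rnDeriv_pos h₂),
    h₁.ae_le (Measure.rnDeriv_lt_top μ ν), (h₁.trans h₂).ae_le (Measure.rnDeriv_lt_top ν κ)]
    with x hx p1 p2 f1 f2
  simp only [llr]
  rw [← hx, Pi.mul_apply, ENNReal.toReal_mul, Real.log_mul]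
  · exact (ENNReal.toReal_pos p1.ne' f1.ne).ne'
  · exact (ENNReal.toReal_pos p2.ne' f2.ne).ne'

/-- Adding `G i` makes every summand nonnegative, and a nonnegative summand is dominated by the
integrable total. -/
theorem integrable_of_integrable_sum_of_neg_le {P : Measure α} {X G : ι → α → ℝ}
    (hX : ∀ i, AEStronglyMeasurable (X i) P) (hG : ∀ i, Integrable (G i) P)
    (hXG : ∀ i, ∀ᵐ x ∂P, -X i x ≤ G i x) (hsum : Integrable (fun x => ∑ i, X i x) P) (i : ι) :
    Integrable (X i) P := by
  have h1 : Integrable (fun x => ∑ j, (X j x + G j x)) P := by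
    simp_rw [Finset.sum_add_distrib]
    exact hsum.add (integrable_finsetSum _ fun j _ => hG j)
  have h2 : Integrable (fun x => X i x + G i x) P := by
    refine h1.mono' ((hX i).add (hG i).aestronglyMeasurable) ?_
    filter_upwards [ae_all_iff.2 hXG] with x hx
    rw [Real.norm_eq_abs, abs_of_nonneg (by linarith [hx i])]
    exact Finset.single_le_sum (f := fun j => X j x + G j x)
      (fun j _ => by linarith [hx j]) (Finset.mem_univ i)
  refine (h2.sub (hG i)).congr (.of_forall fun x => ?_)
  simp

/-- The inequality `t ≤ exp t` at `t = -llr`; it gives the negative part of a log-likelihood ratio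
an integrable bound. -/
theorem neg_llr_le_rnDeriv (μ ν : Measure α) [IsFiniteMeasure μ]
    [IsFiniteMeasure ν] (h : μ ≪ ν) :
    ∀ᵐ x ∂μ, -llr μ ν x ≤ (ν.rnDeriv μ x).toReal := by
  filter_upwards [exp_neg_llr h] with x hx
  rw [← hx]
  linarith [Real.add_one_le_exp (-llr μ ν x)]

/-- The Kullback-Leibler divergence to a product measure splits into the divergence to the product
of the marginals and the divergences of the marginals. -/
theorem toReal_klDiv_pi_eq_add (P : Measure (ι → ℝ)) [IsProbabilityMeasure P]
    (μ η : ι → Measure ℝ) [∀ i, IsProbabilityMeasure (μ i)] [∀ i, IsProbabilityMeasure (η i)]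
    (hP : ∀ i, P.map (fun x => x i) = μ i) (h₁ : klDiv P (Measure.pi μ) ≠ ∞)
    (h₂ : klDiv P (Measure.pi η) ≠ ∞) :
    (∀ i, klDiv (μ i) (η i) ≠ ∞) ∧ (klDiv P (Measure.pi η)).toReal =
      (klDiv P (Measure.pi μ)).toReal + ∑ i, (klDiv (μ i) (η i)).toReal := by
  obtain ⟨ac₁, int₁⟩ := klDiv_ne_top_iff.1 h₁
  obtain ⟨ac₂, int₂⟩ := klDiv_ne_top_iff.1 h₂
  have ac : ∀ i, μ i ≪ η i := by
    intro i
    have h : P.map (fun x => x i) ≪ (Measure.pi η).map (fun x => x i) :=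
      ac₂.map (measurable_pi_apply i)
    have e' : (Measure.pi η).map (fun x => x i) = η i := (measurePreserving_eval η i).map_eq
    rwa [hP i, e'] at h
  have mp : ∀ i, MeasurePreserving (fun x : ι → ℝ => x i) P (μ i) := fun i =>
    ⟨measurable_pi_apply i, hP i⟩
  -- Chain rule for densities through `Measure.pi μ`; integrating this identity gives the
  -- decomposition.
  have e : ∀ᵐ x ∂P, llr P (Measure.pi η) x = llr P (Measure.pi μ) x +
      ∑ i, llr (μ i) (η i) (x i) := by
    filter_upwards [llr_add_llr ac₁ (pi_absolutelyContinuous μ η ac), ac₁.ae_le (llr_pi μ η ac)]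
      with x hx hx'
    rw [hx, hx']
  have hsum : Integrable (fun x => ∑ i, llr (μ i) (η i) (x i)) P := by
    refine (int₂.sub int₁).congr ?_
    filter_upwards [e] with x hx
    rw [Pi.sub_apply, hx]
    ring
  -- Only the sum is known to be integrable; the one-sided bound on each term excludes cancellation
  -- between terms.
  have hint : ∀ i, Integrable (fun x : ι → ℝ => llr (μ i) (η i) (x i)) P :=
    integrable_of_integrable_sum_of_neg_le (P := P) (X := fun i x => llr (μ i) (η i) (x i))
      (G := fun i x => ((η i).rnDeriv (μ i) (x i)).toReal)
      (fun i => ((measurable_llr _ _).comp (measurable_pi_apply i)).aestronglyMeasurable)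
      (fun i => (mp i).integrable_comp_of_integrable Measure.integrable_toReal_rnDeriv)
      (fun i => (mp i).quasiMeasurePreserving.ae
        (neg_llr_le_rnDeriv _ _ (ac i))) hsum
  have hint' : ∀ i, Integrable (llr (μ i) (η i)) (μ i) := fun i =>
    ((mp i).integrable_comp (measurable_llr _ _).aestronglyMeasurable).1 (hint i)
  have hne : ∀ i, klDiv (μ i) (η i) ≠ ∞ := fun i => klDiv_ne_top (ac i) (hint' i)
  refine ⟨hne, ?_⟩
  rw [toReal_klDiv_of_measure_eq ac₂ (by simp), toReal_klDiv_of_measure_eq ac₁ (by simp),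
    integral_congr_ae e, integral_add int₁ hsum, integral_finsetSum _ fun i _ => hint i]
  congr 1
  refine Finset.sum_congr rfl fun i _ => ?_
  have h := integral_map (μ := P) (φ := fun x => x i) (measurable_pi_apply i).aemeasurable
    (measurable_llr (μ i) (η i)).aestronglyMeasurable
  rw [hP i] at h
  rw [toReal_klDiv_of_measure_eq (ac i) (by simp), h]

theorem toReal_klDiv_pi (μ η : ι → Measure ℝ) [∀ i, IsProbabilityMeasure (μ i)]
    [∀ i, IsProbabilityMeasure (η i)] (h : ∀ i, klDiv (μ i) (η i) ≠ ∞) :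
    klDiv (Measure.pi μ) (Measure.pi η) ≠ ∞ ∧
      (klDiv (Measure.pi μ) (Measure.pi η)).toReal = ∑ i, (klDiv (μ i) (η i)).toReal := by
  have ac : ∀ i, μ i ≪ η i := fun i => (klDiv_ne_top_iff.1 (h i)).1
  have hne : klDiv (Measure.pi μ) (Measure.pi η) ≠ ∞ := by
    refine klDiv_ne_top (pi_absolutelyContinuous μ η ac) ?_
    refine Integrable.congr ?_ (Filter.EventuallyEq.symm (llr_pi μ η ac))
    exact integrable_finsetSum _ fun i _ =>
      (measurePreserving_eval μ i).integrable_comp_of_integrable (klDiv_ne_top_iff.1 (h i)).2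
  refine ⟨hne, ?_⟩
  rw [(toReal_klDiv_pi_eq_add _ μ η (fun i => (measurePreserving_eval μ i).map_eq)
    (by simp) hne).2]
  simp

end KullbackLeibler

/-! ### The loss of a centred Gaussian. -/

section Gaussian

open scoped NNReal Matrix

/-- Chain rule through Lebesgue measure, where both densities are explicit. -/
theorem llr_gaussianReal {v : ℝ≥0} (hv : v ≠ 0) :
    ∀ᵐ x ∂gaussianReal 0 v, llr (gaussianReal 0 v) (gaussianReal 0 1) x =
      (1 - (v : ℝ)⁻¹) / 2 * x ^ 2 - Real.log v / 2 := by
  have ac := gaussianReal_absolutelyContinuous 0 hv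
  have ac' := gaussianReal_absolutelyContinuous' 0 (one_ne_zero (α := ℝ≥0))
  have h1 := llr_add_llr (ac.trans ac') (gaussianReal_absolutelyContinuous 0 one_ne_zero)
  filter_upwards [h1, ac.ae_le (rnDeriv_gaussianReal 0 v), ac.ae_le (rnDeriv_gaussianReal 0 1)]
    with x hx e₁ e₂
  have hv' : (0 : ℝ) < v := by positivity
  simp only [llr, e₁, e₂, toReal_gaussianPDF, gaussianPDFReal] at hx
  simp only [llr]
  rw [← sub_eq_iff_eq_add] at hx
  rw [← hx, Real.log_mul (by positivity) (by positivity),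
    Real.log_mul (by positivity) (by positivity), Real.log_exp, Real.log_exp, Real.log_inv,
    Real.log_inv, Real.log_sqrt (by positivity), Real.log_sqrt (by positivity),
    Real.log_mul (by positivity) (by positivity), NNReal.coe_one, mul_one]
  field_simp
  ring

theorem klDiv_gaussianReal {v : ℝ≥0} (hv : v ≠ 0) :
    klDiv (gaussianReal 0 v) (gaussianReal 0 1) ≠ ∞ ∧
      (klDiv (gaussianReal 0 v) (gaussianReal 0 1)).toReal =
        ((v : ℝ) - 1 - Real.log v) / 2 := by
  have ac : gaussianReal 0 v ≪ gaussianReal 0 1 :=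
    (gaussianReal_absolutelyContinuous 0 hv).trans
      (gaussianReal_absolutelyContinuous' 0 one_ne_zero)
  have hsq : Integrable (fun x : ℝ => x ^ 2) (gaussianReal 0 v) :=
    (memLp_id_gaussianReal (μ := 0) (v := v) 2).integrable_sq
  have hint : Integrable (llr (gaussianReal 0 v) (gaussianReal 0 1)) (gaussianReal 0 v) :=
    ((hsq.const_mul _).sub (integrable_const _)).congr
      (Filter.EventuallyEq.symm (llr_gaussianReal hv))
  have hvar : ∫ x, x ^ 2 ∂gaussianReal 0 v = v := by
    have h := variance_fun_id_gaussianReal (μ := 0) (v := v)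
    rwa [variance_of_integral_eq_zero (by fun_prop) (by simp)] at h
  refine ⟨klDiv_ne_top ac hint, ?_⟩
  have hv' : (v : ℝ) ≠ 0 := by exact_mod_cast hv
  rw [toReal_klDiv_of_measure_eq ac (by simp), integral_congr_ae (llr_gaussianReal hv),
    integral_sub (hsq.const_mul _) (integrable_const _), integral_const_mul, hvar,
    integral_const, probReal_univ, one_smul]
  field_simp

variable {D : ℕ}

theorem map_toEuclideanCLM_multivariateGaussian {S : Matrix (Fin D) (Fin D) ℝ} (hS : S.PosSemidef)
    (A : Matrix (Fin D) (Fin D) ℝ) :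
    (multivariateGaussian 0 S).map (Matrix.toEuclideanCLM (n := Fin D) (𝕜 := ℝ) A) =
      multivariateGaussian 0 (A * S * Aᵀ) := by
  have hS' : (A * S * Aᵀ).PosSemidef := by
    simpa using hS.mul_mul_conjTranspose_same A
  refine Measure.ext_of_charFun (funext fun t => ?_)
  have hadj : ∀ x : EuclideanSpace ℝ (Fin D),
      inner ℝ (Matrix.toEuclideanCLM (n := Fin D) (𝕜 := ℝ) A x) t =
        inner ℝ x (Matrix.toEuclideanCLM (n := Fin D) (𝕜 := ℝ) Aᵀ t) := by
    intro x
    rw [real_inner_comm, Matrix.inner_toEuclideanCLM, Matrix.inner_toEuclideanCLM]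
    rw [Matrix.dotProduct_mulVec, ← Matrix.mulVec_transpose, dotProduct_comm]
  have hmap : charFun ((multivariateGaussian 0 S).map
      (Matrix.toEuclideanCLM (n := Fin D) (𝕜 := ℝ) A)) t =
        charFun (multivariateGaussian 0 S) (Matrix.toEuclideanCLM (n := Fin D) (𝕜 := ℝ) Aᵀ t) := by
    rw [charFun_apply, charFun_apply, integral_map (by fun_prop) (by fun_prop)]
    simp_rw [hadj]
  rw [hmap, charFun_multivariateGaussian hS', charFun_multivariateGaussian hS]
  simp only [inner_zero_right, Matrix.ofLp_toEuclideanCLM, ← Matrix.mulVec_mulVec]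
  rw [Matrix.dotProduct_mulVec t.ofLp A, ← Matrix.mulVec_transpose]

theorem multivariateGaussian_diagonal (v : Fin D → ℝ≥0) :
    multivariateGaussian 0 (Matrix.diagonal fun i => (v i : ℝ)) =
      (Measure.pi fun i => gaussianReal 0 (v i)).map (WithLp.toLp 2) := by
  have h : (Matrix.diagonal fun i => (v i : ℝ)).PosSemidef :=
    Matrix.PosSemidef.diagonal fun i => (v i).2
  refine Measure.ext_of_charFun (funext fun t => ?_)
  rw [charFun_multivariateGaussian h, charFun_pi]
  simp_rw [charFun_gaussianReal, ← Complex.exp_sum]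
  simp only [inner_zero_right, dotProduct, Matrix.mulVec_diagonal]
  congr 1
  push_cast
  simp only [mul_zero, zero_mul, zero_sub, Finset.sum_div, Finset.sum_neg_distrib]
  congr 1
  exact Finset.sum_congr rfl fun i _ => by ring

theorem rot_mul (Q R : OD D) (x : EuclideanSpace ℝ (Fin D)) : rot (Q * R) x = rot Q (rot R x) := by
  simp [rot]

theorem rot_one (x : EuclideanSpace ℝ (Fin D)) : rot (1 : OD D) x = x := by
  simp [rot]

theorem measurable_rot (Q : OD D) : Measurable (rot Q) := by
  unfold rot
  fun_prop

/-- The rotation layer as a measurable equivalence. -/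
noncomputable def rotEquiv (Q : OD D) : EuclideanSpace ℝ (Fin D) ≃ᵐ EuclideanSpace ℝ (Fin D) where
  toFun := rot Q
  invFun := rot Q⁻¹
  left_inv x := by rw [← rot_mul, inv_mul_cancel, rot_one]
  right_inv x := by rw [← rot_mul, mul_inv_cancel, rot_one]
  measurable_toFun := measurable_rot Q
  measurable_invFun := measurable_rot Q⁻¹

theorem map_rot_gaussianData {S : Matrix (Fin D) (Fin D) ℝ} (hS : S.PosSemidef) (Q : OD D) :
    (gaussianData S).map (rot Q) = gaussianData (Q.1 * S * Q.1ᵀ) :=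
  map_toEuclideanCLM_multivariateGaussian hS Q.1

theorem mul_transpose_self (Q : OD D) : Q.1 * Q.1ᵀ = 1 :=
  (Matrix.mem_orthogonalGroup_iff _ _).1 Q.2

theorem transpose_mul_self (Q : OD D) : Q.1ᵀ * Q.1 = 1 :=
  (Matrix.mem_orthogonalGroup_iff' _ _).1 Q.2

theorem map_rot_stdGaussian (Q : OD D) :
    (stdGaussian (EuclideanSpace ℝ (Fin D))).map (rot Q) = stdGaussian _ := by
  have h := map_rot_gaussianData (D := D) Matrix.PosSemidef.one Q
  simpa [gaussianData, mul_transpose_self] using h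

theorem loss_map_rot (Q : OD D) (q : Measure (EuclideanSpace ℝ (Fin D))) [IsFiniteMeasure q] :
    loss (q.map (rot Q)) = loss q := by
  unfold loss
  conv_lhs => rw [← map_rot_stdGaussian Q]
  exact klDiv_map_measurableEquiv (rotEquiv Q) _ _

theorem klDiv_map_toLp (μ ν : Measure (Fin D → ℝ)) [IsFiniteMeasure μ] [IsFiniteMeasure ν] :
    klDiv (μ.map (WithLp.toLp 2)) (ν.map (WithLp.toLp 2)) = klDiv μ ν :=
  klDiv_map_measurableEquiv (MeasurableEquiv.toLp 2 (Fin D → ℝ)) μ ν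

theorem loss_gaussianData_diagonal {v : Fin D → ℝ≥0} (hv : ∀ i, v i ≠ 0) :
    loss (gaussianData (Matrix.diagonal fun i => (v i : ℝ))) ≠ ∞ ∧
      (loss (gaussianData (Matrix.diagonal fun i => (v i : ℝ)))).toReal =
        ∑ i, ((v i : ℝ) - 1 - Real.log (v i)) / 2 := by
  have h := toReal_klDiv_pi (fun i => gaussianReal 0 (v i)) (fun _ => gaussianReal 0 1)
    fun i => (klDiv_gaussianReal (hv i)).1
  rw [loss, gaussianData, multivariateGaussian_diagonal, ← map_pi_eq_stdGaussian, klDiv_map_toLp]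
  refine ⟨h.1, h.2.trans ?_⟩
  exact Finset.sum_congr rfl fun i _ => (klDiv_gaussianReal (hv i)).2

theorem exists_orthogonal_diagonalization {S : Matrix (Fin D) (Fin D) ℝ} (hS : S.PosDef) :
    ∃ (U : OD D) (v : Fin D → ℝ), (∀ i, 0 < v i) ∧ S = U.1 * Matrix.diagonal v * U.1ᵀ := by
  refine ⟨hS.1.eigenvectorUnitary, hS.1.eigenvalues, hS.eigenvalues_pos, ?_⟩
  have h := hS.1.spectral_theorem
  rw [Unitary.conjStarAlgAut_apply] at h
  exact h

theorem det_conj (Q : OD D) (S : Matrix (Fin D) (Fin D) ℝ) :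
    (Q.1 * S * Q.1ᵀ).det = S.det := by
  have h := congrArg Matrix.det (mul_transpose_self Q)
  rw [Matrix.det_mul, Matrix.det_one] at h
  rw [Matrix.det_mul, Matrix.det_mul, mul_right_comm, h, one_mul]

theorem trace_conj (Q : OD D) (S : Matrix (Fin D) (Fin D) ℝ) :
    (Q.1 * S * Q.1ᵀ).trace = S.trace := by
  rw [Matrix.trace_mul_comm, ← Matrix.mul_assoc, transpose_mul_self, Matrix.one_mul]

instance isProbabilityMeasure_gaussianData (S : Matrix (Fin D) (Fin D) ℝ) :
    IsProbabilityMeasure (gaussianData S) := by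
  unfold gaussianData
  infer_instance

/-- The loss is rotation invariant because the standard Gaussian is, so `S` may be taken diagonal;
the divergence is then a sum over coordinates. -/
theorem loss_gaussianData {S : Matrix (Fin D) (Fin D) ℝ} (hS : S.PosDef) :
    loss (gaussianData S) ≠ ∞ ∧
      (loss (gaussianData S)).toReal = (S.trace - D - Real.log S.det) / 2 := by
  obtain ⟨U, v, hv, hSU⟩ := exists_orthogonal_diagonalization hS
  have hsd : (Matrix.diagonal v).PosSemidef := Matrix.PosSemidef.diagonal fun i => (hv i).le
  have h := loss_gaussianData_diagonal (v := fun i => ⟨v i, (hv i).le⟩)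
    fun i => NNReal.coe_ne_zero.1 (hv i).ne'
  have h' : loss (gaussianData S) = loss (gaussianData (Matrix.diagonal v)) := by
    rw [hSU, ← map_rot_gaussianData hsd, loss_map_rot]
  rw [h']
  refine ⟨h.1, h.2.trans ?_⟩
  change ∑ i, (v i - 1 - Real.log (v i)) / 2 = _
  have e₁ : S.trace = ∑ i, v i := by rw [hSU, trace_conj, Matrix.trace_diagonal]
  have e₂ : S.det = ∏ i, v i := by rw [hSU, det_conj, Matrix.det_diagonal]
  rw [e₁, e₂, Real.log_prod fun i _ => (hv i).ne', ← Finset.sum_div]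
  simp [Finset.sum_sub_distrib]

end Gaussian

/-! ### The trained layer is the standardization of the coordinates. -/

section Training

open scoped NNReal Matrix

theorem strictMono_gaussianReal_Iic {v : ℝ≥0} (hv : v ≠ 0) :
    StrictMono fun x : ℝ => gaussianReal 0 v (Set.Iic x) := by
  intro x y hxy
  have h : gaussianReal 0 v (Set.Iic y) =
      gaussianReal 0 v (Set.Iic x) + gaussianReal 0 v (Set.Ioc x y) := by
    rw [← measure_union (Set.Iic_disjoint_Ioc le_rfl) measurableSet_Ioc,
      Set.Iic_union_Ioc_eq_Iic hxy.le]
  have hpos : gaussianReal 0 v (Set.Ioc x y) ≠ 0 := by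
    intro h0
    have := gaussianReal_absolutelyContinuous' 0 hv h0
    rw [Real.volume_Ioc, ENNReal.ofReal_eq_zero] at this
    linarith
  change gaussianReal 0 v (Set.Iic x) < gaussianReal 0 v (Set.Iic y)
  rw [h]
  exact ENNReal.lt_add_right (measure_ne_top _ _) hpos

/-- Invariance of the law makes the distribution function agree at `T x` and `x`, and it is
injective. -/
theorem orderIso_eq_refl_of_map_gaussianReal {v : ℝ≥0} (hv : v ≠ 0) (T : ℝ ≃o ℝ)
    (h : (gaussianReal 0 v).map T = gaussianReal 0 v) : T = OrderIso.refl ℝ := by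
  ext x
  refine (strictMono_gaussianReal_Iic hv).injective ?_
  change gaussianReal 0 v (Set.Iic (T x)) = gaussianReal 0 v (Set.Iic x)
  conv_lhs => rw [← h]
  rw [Measure.map_apply T.continuous.measurable measurableSet_Iic]
  congr 1
  ext y
  simp

variable {D : ℕ}

theorem measurable_dimwise (T : Fin D → (ℝ ≃o ℝ)) : Measurable (dimwise T) := by
  refine (MeasurableEquiv.toLp 2 (Fin D → ℝ)).measurable.comp (measurable_pi_lambda _ fun i => ?_)
  exact (T i).continuous.measurable.comp (by fun_prop)

/-- The dimension-wise layer as a measurable equivalence. -/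
def dimwiseEquiv (T : Fin D → (ℝ ≃o ℝ)) :
    EuclideanSpace ℝ (Fin D) ≃ᵐ EuclideanSpace ℝ (Fin D) where
  toFun := dimwise T
  invFun := dimwise fun i => (T i).symm
  left_inv x := by ext i; simp [dimwise]
  right_inv x := by ext i; simp [dimwise]
  measurable_toFun := measurable_dimwise T
  measurable_invFun := measurable_dimwise _

theorem map_dimwise_stdGaussian (T : Fin D → (ℝ ≃o ℝ)) :
    (stdGaussian (EuclideanSpace ℝ (Fin D))).map (dimwise T) =
      (Measure.pi fun i => (gaussianReal 0 1).map (T i)).map (WithLp.toLp 2) := by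
  have hT : ∀ i, AEMeasurable (T i) (gaussianReal 0 1) := fun i =>
    (T i).continuous.measurable.aemeasurable
  have hp : ∀ i, IsProbabilityMeasure ((gaussianReal 0 1).map (T i)) := fun i =>
    Measure.isProbabilityMeasure_map (hT i)
  have hm : Measurable fun (x : Fin D → ℝ) i => T i (x i) :=
    measurable_pi_lambda _ fun i => (T i).continuous.measurable.comp (measurable_pi_apply i)
  rw [← map_pi_eq_stdGaussian, ← Measure.pi_map_pi hT,
    Measure.map_map (measurable_dimwise T) (by fun_prop), Measure.map_map (by fun_prop) hm]
  rfl

/-- The layer is moved from the data to the reference measure, which remains a product, so that the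
decomposition into marginals applies. -/
theorem loss_map_dimwise (q : Measure (EuclideanSpace ℝ (Fin D))) [IsFiniteMeasure q]
    (T : Fin D → (ℝ ≃o ℝ)) :
    loss (q.map (dimwise T)) = klDiv (q.map WithLp.ofLp)
      (Measure.pi fun i => (gaussianReal 0 1).map (T i).symm) := by
  have hp : ∀ i, IsProbabilityMeasure ((gaussianReal 0 1).map (T i).symm) := fun i =>
    Measure.isProbabilityMeasure_map (T i).symm.continuous.measurable.aemeasurable
  have h1 := klDiv_map_measurableEquiv (dimwiseEquiv T).symm (q.map (dimwiseEquiv T))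
    (stdGaussian (EuclideanSpace ℝ (Fin D)))
  rw [MeasurableEquiv.map_symm_map] at h1
  rw [← klDiv_map_toLp, Measure.map_map (by fun_prop) (by fun_prop)]
  have h2 : q.map (WithLp.toLp 2 ∘ WithLp.ofLp) = q := by
    exact Measure.map_id
  rw [h2, ← map_dimwise_stdGaussian]
  exact h1.symm

/-- Data with standard Gaussian marginals cannot be improved by a dimension-wise layer, and the
identity is the only optimal one. -/
theorem loss_le_loss_map_dimwise {q : Measure (EuclideanSpace ℝ (Fin D))} [IsProbabilityMeasure q]
    (hq : ∀ i, q.map (fun x => x i) = gaussianReal 0 1) (hfin : loss q ≠ ∞)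
    (T : Fin D → (ℝ ≃o ℝ)) :
    loss q ≤ loss (q.map (dimwise T)) ∧
      (loss (q.map (dimwise T)) ≤ loss q → T = fun _ => OrderIso.refl ℝ) := by
  have hp : ∀ i, IsProbabilityMeasure ((gaussianReal 0 1).map (T i).symm) := fun i =>
    Measure.isProbabilityMeasure_map (T i).symm.continuous.measurable.aemeasurable
  have hid : loss q = klDiv (q.map WithLp.ofLp) (Measure.pi fun _ => gaussianReal 0 1) := by
    have h := loss_map_dimwise q fun _ => OrderIso.refl ℝ
    have e : q.map (dimwise fun _ => OrderIso.refl ℝ) = q := Measure.map_id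
    have e' : (gaussianReal 0 1).map (OrderIso.refl ℝ).symm = gaussianReal 0 1 := Measure.map_id
    rwa [e, e'] at h
  have hprob : IsProbabilityMeasure (q.map WithLp.ofLp) :=
    Measure.isProbabilityMeasure_map (by fun_prop)
  rw [loss_map_dimwise, hid]
  rw [hid] at hfin
  by_cases htop : klDiv (q.map WithLp.ofLp)
      (Measure.pi fun i => (gaussianReal 0 1).map (T i).symm) = ∞
  · rw [htop]
    exact ⟨le_top, fun h => absurd (top_le_iff.1 h) hfin⟩
  have hmarg : ∀ i, (q.map WithLp.ofLp).map (fun x => x i) = gaussianReal 0 1 := fun i => by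
    rw [Measure.map_map (by fun_prop) (by fun_prop), ← hq i]
    rfl
  obtain ⟨hne, hadd⟩ := toReal_klDiv_pi_eq_add (q.map WithLp.ofLp) (fun _ => gaussianReal 0 1)
    (fun i => (gaussianReal 0 1).map (T i).symm) hmarg hfin htop
  constructor
  · rw [← ENNReal.toReal_le_toReal hfin htop, hadd]
    exact le_add_of_nonneg_right (Finset.sum_nonneg fun i _ => ENNReal.toReal_nonneg)
  · intro hle
    rw [← ENNReal.toReal_le_toReal htop hfin, hadd] at hle
    have h0 := (Finset.sum_eq_zero_iff_of_nonneg fun i _ => ENNReal.toReal_nonneg).1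
      (le_antisymm (by linarith) (Finset.sum_nonneg fun i (_ : i ∈ Finset.univ) =>
        ENNReal.toReal_nonneg (a := klDiv (gaussianReal 0 1) ((gaussianReal 0 1).map (T i).symm))))
    funext i
    have h1 := (ENNReal.toReal_eq_zero_iff _).1 (h0 i (Finset.mem_univ i))
    have h2 := klDiv_eq_zero_iff.1 (h1.resolve_right (hne i))
    have h3 := orderIso_eq_refl_of_map_gaussianReal one_ne_zero _ h2.symm
    rw [← OrderIso.symm_symm (T i), h3]
    rfl

/-- The correlation matrix of a covariance matrix. -/
noncomputable def correlation (A : Matrix (Fin D) (Fin D) ℝ) : Matrix (Fin D) (Fin D) ℝ :=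
  Matrix.diagonal (fun i => (√(A i i))⁻¹) * A * (Matrix.diagonal fun i => (√(A i i))⁻¹)ᵀ

theorem correlation_apply (A : Matrix (Fin D) (Fin D) ℝ) (i j : Fin D) :
    correlation A i j = (√(A i i))⁻¹ * A i j * (√(A j j))⁻¹ := by
  rw [correlation, Matrix.diagonal_transpose, Matrix.mul_diagonal, Matrix.diagonal_mul]

theorem correlation_diag {A : Matrix (Fin D) (Fin D) ℝ} (hA : A.PosDef) (i : Fin D) :
    correlation A i i = 1 := by
  have h : 0 < A i i := hA.diag_pos
  rw [correlation_apply]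
  field_simp
  rw [Real.sq_sqrt h.le]

theorem posDef_correlation {A : Matrix (Fin D) (Fin D) ℝ} (hA : A.PosDef) :
    (correlation A).PosDef := by
  have h := hA.mul_mul_conjTranspose_same (B := Matrix.diagonal fun i => (√(A i i))⁻¹) ?_
  · simpa [correlation] using h
  · refine Matrix.vecMul_injective_of_isUnit ?_
    rw [Matrix.isUnit_iff_isUnit_det, Matrix.det_diagonal, isUnit_iff_ne_zero]
    exact Finset.prod_ne_zero_iff.2 fun i _ =>
      inv_ne_zero (Real.sqrt_ne_zero'.2 hA.diag_pos)

theorem det_correlation {A : Matrix (Fin D) (Fin D) ℝ} (hA : A.PosDef) :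
    (correlation A).det = A.det / ∏ i, A i i := by
  rw [correlation, Matrix.det_mul, Matrix.det_mul, Matrix.det_transpose, Matrix.det_diagonal,
    mul_right_comm, ← Finset.prod_mul_distrib, div_eq_inv_mul, ← Finset.prod_inv_distrib]
  congr 1
  refine Finset.prod_congr rfl fun i _ => ?_
  rw [← mul_inv, Real.mul_self_sqrt hA.diag_pos.le]

/-- The standardization of the coordinates. -/
noncomputable def standardize {A : Matrix (Fin D) (Fin D) ℝ} (hA : A.PosDef) :
    Fin D → (ℝ ≃o ℝ) := fun i =>
  OrderIso.mulLeft₀ (√(A i i))⁻¹ (inv_pos.2 (Real.sqrt_pos.2 hA.diag_pos))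

theorem map_standardize_gaussianData {A : Matrix (Fin D) (Fin D) ℝ} (hA : A.PosDef) :
    (gaussianData A).map (dimwise (standardize hA)) = gaussianData (correlation A) := by
  have h := map_toEuclideanCLM_multivariateGaussian hA.posSemidef
    (Matrix.diagonal fun i => (√(A i i))⁻¹)
  rw [gaussianData, gaussianData, correlation, ← h]
  congr 1
  ext x i
  simp [dimwise, standardize, Matrix.mulVec_diagonal]

/-- Any layer factors through standardization, which reduces optimality for `A` to data with
standard normal marginals. -/
theorem map_dimwise_gaussianData {A : Matrix (Fin D) (Fin D) ℝ} (hA : A.PosDef)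
    (T : Fin D → (ℝ ≃o ℝ)) : (gaussianData A).map (dimwise T) =
      (gaussianData (correlation A)).map
        (dimwise fun i => (standardize hA i).symm.trans (T i)) := by
  rw [← map_standardize_gaussianData hA,
    Measure.map_map (measurable_dimwise _) (measurable_dimwise _)]
  congr 1
  ext x i
  simp [dimwise]

theorem map_eval_gaussianData_correlation {A : Matrix (Fin D) (Fin D) ℝ} (hA : A.PosDef)
    (i : Fin D) : (gaussianData (correlation A)).map (fun x => x i) = gaussianReal 0 1 := by
  have h := (measurePreserving_eval_multivariateGaussian (μ := 0)
    (posDef_correlation hA).posSemidef (i := i)).map_eq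
  rw [correlation_diag hA, Real.toNNReal_one] at h
  exact h

/-- Uniqueness matters because `trainedLayer` picks an arbitrary minimizer. -/
theorem eq_standardize_of_isTrained {A : Matrix (Fin D) (Fin D) ℝ} (hA : A.PosDef)
    {T : Fin D → (ℝ ≃o ℝ)} (hT : IsTrained (gaussianData A) T) : T = standardize hA := by
  have h := hT (standardize hA)
  set T' : Fin D → (ℝ ≃o ℝ) := fun i => (standardize hA i).symm.trans (T i)
  rw [map_dimwise_gaussianData hA T, map_standardize_gaussianData] at h
  have h' := (loss_le_loss_map_dimwise (map_eval_gaussianData_correlation hA)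
    (loss_gaussianData (posDef_correlation hA)).1 T').2 h
  funext i
  ext x
  have := congrArg (fun f => f (standardize hA i x)) (congrFun h' i)
  simpa [T'] using this

theorem isTrained_standardize {A : Matrix (Fin D) (Fin D) ℝ} (hA : A.PosDef) :
    IsTrained (gaussianData A) (standardize hA) := by
  intro T
  set T' : Fin D → (ℝ ≃o ℝ) := fun i => (standardize hA i).symm.trans (T i)
  rw [map_dimwise_gaussianData hA T, map_standardize_gaussianData]
  exact (loss_le_loss_map_dimwise (map_eval_gaussianData_correlation hA)
    (loss_gaussianData (posDef_correlation hA)).1 T').1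

theorem trainedLayer_gaussianData {A : Matrix (Fin D) (Fin D) ℝ} (hA : A.PosDef) :
    trainedLayer (gaussianData A) = standardize hA := by
  have h : ∃ T, IsTrained (gaussianData A) T := ⟨_, isTrained_standardize hA⟩
  rw [trainedLayer, dif_pos h]
  exact eq_standardize_of_isTrained hA h.choose_spec

theorem posDef_conj {S : Matrix (Fin D) (Fin D) ℝ} (hS : S.PosDef) (Q : OD D) :
    (Q.1 * S * Q.1ᵀ).PosDef := by
  refine hS.mul_mul_conjTranspose_same (Matrix.vecMul_injective_of_isUnit ?_)
  exact (Matrix.isUnit_iff_isUnit_det _).2 (Matrix.UnitaryGroup.det_isUnit Q)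

/-- The covariance matrix after a trained block, for Gaussian data with covariance `S`. -/
noncomputable def nextCov (Q : OD D) (S : Matrix (Fin D) (Fin D) ℝ) : Matrix (Fin D) (Fin D) ℝ :=
  correlation (Q.1 * S * Q.1ᵀ)

theorem block_gaussianData {S : Matrix (Fin D) (Fin D) ℝ} (hS : S.PosDef) (Q : OD D) :
    block Q (gaussianData S) = gaussianData (nextCov Q S) := by
  rw [block, map_rot_gaussianData hS.posSemidef, trainedLayer_gaussianData (posDef_conj hS Q),
    map_standardize_gaussianData, nextCov]

theorem isNormalizedCov_nextCov {S : Matrix (Fin D) (Fin D) ℝ} (hS : S.PosDef) (Q : OD D) :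
    IsNormalizedCov (nextCov Q S) := by
  refine ⟨posDef_correlation (posDef_conj hS Q), ?_⟩
  simp [Matrix.trace, nextCov, correlation_diag (posDef_conj hS Q)]

theorem initialLoss_eq {S : Matrix (Fin D) (Fin D) ℝ} (hS : IsNormalizedCov S) :
    initialLoss S = -Real.log S.det / 2 := by
  rw [initialLoss, (loss_gaussianData hS.1).2, hS.2, sub_self, zero_sub]

theorem initialLoss_nextCov {S : Matrix (Fin D) (Fin D) ℝ} (hS : IsNormalizedCov S) (Q : OD D) :
    initialLoss (nextCov Q S) =
      initialLoss S + (∑ i, Real.log ((Q.1 * S * Q.1ᵀ) i i)) / 2 := by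
  have hA := posDef_conj hS.1 Q
  have hpos : ∀ i, (Q.1 * S * Q.1ᵀ) i i ≠ 0 := fun i => hA.diag_pos.ne'
  rw [initialLoss_eq (isNormalizedCov_nextCov hS.1 Q), initialLoss_eq hS, nextCov,
    det_correlation hA, Real.log_div hA.det_pos.ne' (Finset.prod_ne_zero_iff.2 fun i _ => hpos i),
    Real.log_prod fun i _ => hpos i, det_conj]
  ring

end Training

/-! ### Fourth moments of Haar-random orthogonal matrices. -/

section Haar

open scoped Matrix

variable {D : ℕ}

instance instSecondCountableTopologyOD : SecondCountableTopology (OD D) :=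
  haveI : SecondCountableTopology (Matrix (Fin D) (Fin D) ℝ) :=
    inferInstanceAs (SecondCountableTopology (Fin D → Fin D → ℝ))
  TopologicalSpace.Subtype.secondCountableTopology _

instance instIsHaarMeasureHaarOD : (haarOD D).IsHaarMeasure := by
  unfold haarOD
  infer_instance

/-- A right translate of Haar measure is again a left-invariant probability measure, and that is
unique. -/
theorem map_mul_right_haarOD (V : OD D) : (haarOD D).map (fun Q => Q * V) = haarOD D := by
  have h1 : IsProbabilityMeasure ((haarOD D).map (fun Q => Q * V)) :=
    Measure.isProbabilityMeasure_map (by fun_prop)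
  exact Measure.isHaarMeasure_eq_of_isProbabilityMeasure _ _

theorem integral_comp_mul_right (f : OD D → ℝ) (V : OD D) :
    ∫ Q, f (Q * V) ∂haarOD D = ∫ Q, f Q ∂haarOD D := by
  conv_rhs => rw [← map_mul_right_haarOD V]
  exact ((Homeomorph.mulRight V).measurableEmbedding.integral_map f).symm

/-- The Householder reflection along `u - w` exchanges two vectors of equal length. -/
theorem exists_orthogonal_mulVec (u w : Fin D → ℝ) (h : u ⬝ᵥ u = w ⬝ᵥ w) :
    ∃ V : OD D, V.1 *ᵥ u = w := by
  by_cases huw : u = w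
  · exact ⟨1, by simp [huw]⟩
  set v := u - w with hv
  have hvv : v ⬝ᵥ v ≠ 0 := fun h0 => huw (sub_eq_zero.1 (dotProduct_self_eq_zero.1 h0))
  have hvu : 2 * (v ⬝ᵥ u) = v ⬝ᵥ v := by
    simp only [hv, sub_dotProduct, dotProduct_sub, dotProduct_comm w u]
    linarith
  refine ⟨⟨1 - (2 / (v ⬝ᵥ v)) • Matrix.vecMulVec v v, ?_⟩, ?_⟩
  · rw [Matrix.mem_orthogonalGroup_iff]
    simp only [Matrix.transpose_sub, Matrix.transpose_one, Matrix.transpose_smul,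
      Matrix.transpose_vecMulVec, Matrix.sub_mul, Matrix.mul_sub, Matrix.one_mul, Matrix.mul_one,
      Matrix.smul_mul, Matrix.mul_smul, Matrix.vecMulVec_mul_vecMulVec]
    ext i j
    simp only [Matrix.sub_apply, Matrix.smul_apply, Matrix.vecMulVec_apply, Pi.smul_apply,
      smul_eq_mul]
    field_simp
    ring
  · simp only [Matrix.sub_mulVec, Matrix.one_mulVec, Matrix.smul_mulVec, Matrix.vecMulVec_mulVec]
    have : v ⬝ᵥ u = v ⬝ᵥ v / 2 := by linarith
    ext i
    simp only [this, Pi.sub_apply, Pi.smul_apply, smul_eq_mul, MulOpposite.smul_eq_mul_unop,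
      MulOpposite.unop_op]
    field_simp
    simp [hv]

theorem integrable_of_continuous {X : Type*} [TopologicalSpace X] [CompactSpace X]
    [MeasurableSpace X] [OpensMeasurableSpace X] {μ : Measure X} [IsFiniteMeasure μ] {f : X → ℝ}
    (hf : Continuous f) : Integrable f μ :=
  hf.integrable_of_hasCompactSupport (HasCompactSupport.of_compactSpace f)

theorem continuous_mulVec_apply (u : Fin D → ℝ) (i : Fin D) :
    Continuous fun Q : OD D => (Q.1 *ᵥ u) i := by
  fun_prop

theorem continuous_entry (i j : Fin D) : Continuous fun Q : OD D => Q.1 i j :=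
  continuous_subtype_val.matrix_elem i j

/-- By right invariance only the length of `u` matters. The reference vector could be any unit
vector; its moment is found later by normalization. -/
theorem integral_mulVec_pow_four (i : Fin D) (u : Fin D → ℝ) :
    ∫ Q : OD D, (Q.1 *ᵥ u) i ^ 4 ∂haarOD D =
      (u ⬝ᵥ u) ^ 2 * ∫ Q : OD D, (Q.1 *ᵥ Pi.single i 1) i ^ 4 ∂haarOD D := by
  have hu : 0 ≤ u ⬝ᵥ u := by
    simpa using dotProduct_star_self_nonneg u
  obtain ⟨V, hV⟩ := exists_orthogonal_mulVec (√(u ⬝ᵥ u) • Pi.single i (1 : ℝ)) u (by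
    simp [Real.mul_self_sqrt hu])
  have h1 : ∀ Q : OD D, (Q.1 *ᵥ u) i ^ 4 =
      (u ⬝ᵥ u) ^ 2 * ((Q * V).1 *ᵥ Pi.single i (1 : ℝ)) i ^ 4 := by
    intro Q
    have h2 : (√(u ⬝ᵥ u)) ^ 4 = (u ⬝ᵥ u) ^ 2 := by
      rw [show 4 = 2 * 2 from rfl, pow_mul, Real.sq_sqrt hu]
    conv_lhs => rw [← hV]
    rw [Matrix.mulVec_smul, Matrix.mulVec_smul, Matrix.mulVec_mulVec, Pi.smul_apply, smul_eq_mul,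
      mul_pow, h2]
    rfl
  simp_rw [h1]
  rw [integral_const_mul, integral_comp_mul_right
    (fun Q => (Q.1 *ᵥ Pi.single i (1 : ℝ)) i ^ 4) V]

theorem sum_sq_row (Q : OD D) (i : Fin D) : ∑ j, Q.1 i j ^ 2 = 1 := by
  have h := congrFun (congrFun (mul_transpose_self Q) i) i
  rw [Matrix.mul_apply, Matrix.one_apply_eq] at h
  rw [← h]
  exact Finset.sum_congr rfl fun j _ => by rw [Matrix.transpose_apply, sq]

/-- Fourth moments of the rows of a Haar-random orthogonal matrix. -/
theorem integral_sq_mul_sq (i j k : Fin D) :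
    ∫ Q : OD D, Q.1 i j ^ 2 * Q.1 i k ^ 2 ∂haarOD D =
      (1 + 2 * if j = k then 1 else 0) / ((D : ℝ) * (D + 2)) := by
  set c := ∫ Q : OD D, (Q.1 *ᵥ Pi.single i 1) i ^ 4 ∂haarOD D with hc
  have hM : ∀ j k : Fin D, ∫ Q : OD D, Q.1 i j ^ 2 * Q.1 i k ^ 2 ∂haarOD D =
      c / 3 * (1 + 2 * if j = k then 1 else 0) := by
    intro j k
    have e := fun u => integral_mulVec_pow_four (D := D) i u
    rw [← hc] at e
    set u : Fin D → ℝ := Pi.single j 1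
    set w : Fin D → ℝ := Pi.single k 1
    -- Polarization: `12 a² b² = (a + b)⁴ + (a - b)⁴ - 2 a⁴ - 2 b⁴`.
    have hpol : ∀ Q : OD D, Q.1 i j ^ 2 * Q.1 i k ^ 2 =
        ((Q.1 *ᵥ (u + w)) i ^ 4 + (Q.1 *ᵥ (u - w)) i ^ 4 - 2 * (Q.1 *ᵥ u) i ^ 4 -
          2 * (Q.1 *ᵥ w) i ^ 4) / 12 := by
      intro Q
      simp only [Matrix.mulVec_add, Matrix.mulVec_sub, Pi.add_apply, Pi.sub_apply, u, w,
        Matrix.mulVec_single_one, Matrix.col_apply]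
      ring
    have hi : ∀ u : Fin D → ℝ, Integrable (fun Q : OD D => (Q.1 *ᵥ u) i ^ 4) (haarOD D) :=
      fun u => integrable_of_continuous ((continuous_mulVec_apply u i).pow 4)
    simp_rw [hpol]
    have hi₁ : Integrable (fun Q : OD D => (Q.1 *ᵥ (u + w)) i ^ 4 + (Q.1 *ᵥ (u - w)) i ^ 4)
        (haarOD D) := (hi _).add (hi _)
    have hi₂ : Integrable (fun Q : OD D => (Q.1 *ᵥ (u + w)) i ^ 4 + (Q.1 *ᵥ (u - w)) i ^ 4 -
        2 * (Q.1 *ᵥ u) i ^ 4) (haarOD D) := hi₁.sub ((hi _).const_mul 2)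
    rw [integral_div, integral_sub hi₂ ((hi _).const_mul 2),
      integral_sub hi₁ ((hi _).const_mul 2), integral_add (hi _) (hi _), integral_const_mul,
      integral_const_mul, e, e, e, e]
    have huu : u ⬝ᵥ u = 1 := by simp [u]
    have hww : w ⬝ᵥ w = 1 := by simp [w]
    have huw : u ⬝ᵥ w = if j = k then 1 else 0 := by
      simp [u, w, Pi.single_apply, eq_comm]
    simp only [add_dotProduct, sub_dotProduct, dotProduct_add, dotProduct_sub, huu, hww, huw,
      dotProduct_comm w u]
    split_ifs <;> ring
  -- Rows are unit vectors, so the moments sum to `1`; this forces `c = 3 / (D (D + 2))`.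
  have hsum : ∑ j, ∑ k, ∫ Q : OD D, Q.1 i j ^ 2 * Q.1 i k ^ 2 ∂haarOD D = 1 := by
    have hi : ∀ j k : Fin D, Integrable (fun Q : OD D => Q.1 i j ^ 2 * Q.1 i k ^ 2) (haarOD D) :=
      fun j k => integrable_of_continuous
        (((continuous_entry i j).pow 2).mul ((continuous_entry i k).pow 2))
    simp_rw [← integral_finsetSum _ fun k _ => hi _ k]
    rw [← integral_finsetSum _ fun j _ => integrable_finsetSum _ fun k _ => hi j k]
    simp_rw [← Finset.mul_sum, sum_sq_row, mul_one, sum_sq_row]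
    simp
  have hD : (0 : ℝ) < D := by exact_mod_cast i.pos
  simp_rw [hM, ← Finset.mul_sum, Finset.sum_add_distrib, ← Finset.mul_sum] at hsum
  simp only [Finset.sum_const, Finset.card_univ, Fintype.card_fin, nsmul_eq_mul, mul_one,
    Finset.sum_ite_eq, Finset.mem_univ, if_true] at hsum
  rw [hM, eq_div_iff (by positivity)]
  linear_combination (1 + 2 * if j = k then (1 : ℝ) else 0) * hsum

/-- The moment matrix is a multiple of the all-ones matrix plus twice the identity; the first part
vanishes on `x` of sum zero. -/
theorem integral_sq_sum_mul_sq (i : Fin D) {x : Fin D → ℝ} (hx : ∑ j, x j = 0) :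
    ∫ Q : OD D, (∑ j, Q.1 i j ^ 2 * x j) ^ 2 ∂haarOD D =
      2 / ((D : ℝ) * (D + 2)) * ∑ j, x j ^ 2 := by
  have hexp : ∀ Q : OD D, (∑ j, Q.1 i j ^ 2 * x j) ^ 2 =
      ∑ j, ∑ k, x j * x k * (Q.1 i j ^ 2 * Q.1 i k ^ 2) := by
    intro Q
    rw [sq, Finset.sum_mul_sum]
    exact Finset.sum_congr rfl fun j _ => Finset.sum_congr rfl fun k _ => by ring
  have hi : ∀ j k : Fin D,
      Integrable (fun Q : OD D => x j * x k * (Q.1 i j ^ 2 * Q.1 i k ^ 2)) (haarOD D) :=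
    fun j k => (integrable_of_continuous
      (((continuous_entry i j).pow 2).mul ((continuous_entry i k).pow 2))).const_mul _
  simp_rw [hexp]
  rw [integral_finsetSum _ fun j _ => integrable_finsetSum _ fun k _ => hi j k]
  simp_rw [integral_finsetSum _ fun k _ => hi _ k, integral_const_mul, integral_sq_mul_sq]
  have h : ∀ j, ∑ k, x j * x k * ((1 + 2 * if j = k then 1 else 0) / ((D : ℝ) * (D + 2))) =
      x j / ((D : ℝ) * (D + 2)) * ∑ k, x k + 2 / ((D : ℝ) * (D + 2)) * x j ^ 2 := by
    intro j
    have : ∀ k, x j * x k * ((1 + 2 * if j = k then 1 else 0) / ((D : ℝ) * (D + 2))) =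
        x j / ((D : ℝ) * (D + 2)) * x k +
          if j = k then 2 / ((D : ℝ) * (D + 2)) * x j * x k else 0 := by
      intro k
      split_ifs <;> ring
    simp_rw [this, Finset.sum_add_distrib, ← Finset.mul_sum, Finset.sum_ite_eq, Finset.mem_univ,
      if_true]
    ring
  simp_rw [h, hx, mul_zero, zero_add, ← Finset.mul_sum]

theorem conj_diagonal_apply_self (Q : OD D) (v : Fin D → ℝ) (i : Fin D) :
    (Q.1 * Matrix.diagonal v * Q.1ᵀ) i i = ∑ j, Q.1 i j ^ 2 * v j := by
  rw [Matrix.mul_apply]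
  refine Finset.sum_congr rfl fun j _ => ?_
  rw [Matrix.mul_diagonal, Matrix.transpose_apply]
  ring

theorem conj_conj (Q U : OD D) (A : Matrix (Fin D) (Fin D) ℝ) :
    Q.1 * (U.1 * A * U.1ᵀ) * Q.1ᵀ = (Q * U).1 * A * (Q * U).1ᵀ := by
  have h : (Q * U).1 = Q.1 * U.1 := rfl
  rw [h, Matrix.transpose_mul]
  simp only [Matrix.mul_assoc]

/-- Unit rows let `1` be subtracted inside the sum, right invariance absorbs `U`, and each of the
`D` rows contributes equally. -/
theorem integral_sum_sq_diag (U : OD D) {v : Fin D → ℝ} (hv : ∑ i, v i = D) :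
    ∫ Q : OD D, ∑ i, ((Q.1 * (U.1 * Matrix.diagonal v * U.1ᵀ) * Q.1ᵀ) i i - 1) ^ 2 ∂haarOD D =
      2 / ((D : ℝ) + 2) * ∑ j, (v j - 1) ^ 2 := by
  have h1 : ∀ (Q : OD D) (i : Fin D),
      (Q.1 * (U.1 * Matrix.diagonal v * U.1ᵀ) * Q.1ᵀ) i i - 1 =
        ∑ j, (Q * U).1 i j ^ 2 * (v j - 1) := by
    intro Q i
    rw [conj_conj, conj_diagonal_apply_self]
    simp_rw [mul_sub, mul_one, Finset.sum_sub_distrib, sum_sq_row]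
  simp_rw [h1]
  rw [integral_comp_mul_right (fun Q => ∑ i, (∑ j, Q.1 i j ^ 2 * (v j - 1)) ^ 2) U,
    integral_finsetSum]
  · have hx : ∑ j, (v j - 1) = 0 := by simp [Finset.sum_sub_distrib, hv]
    simp_rw [integral_sq_sum_mul_sq _ hx]
    rw [Finset.sum_const, Finset.card_univ, Fintype.card_fin, nsmul_eq_mul]
    rcases D.eq_zero_or_pos with rfl | hD
    · simp
    · field_simp
  · intro i _
    refine integrable_of_continuous ?_
    exact (continuous_finsetSum _ fun j _ =>
      ((continuous_entry i j).pow 2).mul continuous_const).pow 2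

end Haar

/-! ### Scalar inequalities and the spread of the eigenvalues at a given loss. -/

section Estimates

/-- For `t ≤ 1`, `sinh s ≤ s` at `s = log t` gives the bound with `t` in place of `m`. For `t ≥ 1`,
`log t ≥ 2 (t - 1) / (t + 1)` gives it with `1` in place of `m`. -/
theorem sub_one_sub_log_le {m t : ℝ} (hm : 0 < m) (hm1 : m ≤ 1) (ht : m ≤ t) :
    t - 1 - Real.log t ≤ (t - 1) ^ 2 / (2 * m) := by
  have ht0 : 0 < t := hm.trans_le ht
  rcases le_total t 1 with h1 | h1
  · have hs : Real.sinh (Real.log t) ≤ Real.log t :=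
      Real.sinh_le_self_iff.2 (Real.log_nonpos ht0.le h1)
    rw [Real.sinh_log ht0] at hs
    have h2 : t - 1 - (t - t⁻¹) / 2 = (t - 1) ^ 2 / (2 * t) := by
      field_simp
      ring
    have h3 : (t - 1) ^ 2 / (2 * t) ≤ (t - 1) ^ 2 / (2 * m) := by gcongr
    linarith
  · have hl := Real.le_log_one_add_of_nonneg (sub_nonneg.2 h1)
    rw [add_sub_cancel] at hl
    have h2 : (t - 1) - (t - 1) ^ 2 / 2 ≤ 2 * (t - 1) / (t - 1 + 2) := by
      rw [le_div_iff₀ (by linarith)]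
      have : 0 ≤ (t - 1) ^ 3 := pow_nonneg (sub_nonneg.2 h1) 3
      nlinarith
    have h3 : (t - 1) ^ 2 / 2 ≤ (t - 1) ^ 2 / (2 * m) := by
      gcongr
      linarith
    linarith

theorem le_sub_one_sub_log {M t : ℝ} (hM : 1 ≤ M) (ht0 : 0 < t) (ht : t ≤ M) :
    (t - 1) ^ 2 / (2 * M) ≤ t - 1 - Real.log t := by
  rcases le_total 1 t with h1 | h1
  · have hs : Real.log t ≤ Real.sinh (Real.log t) :=
      Real.self_le_sinh_iff.2 (Real.log_nonneg h1)
    rw [Real.sinh_log ht0] at hs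
    have h2 : t - 1 - (t - t⁻¹) / 2 = (t - 1) ^ 2 / (2 * t) := by
      field_simp
      ring
    have h3 : (t - 1) ^ 2 / (2 * M) ≤ (t - 1) ^ 2 / (2 * t) := by gcongr
    linarith
  · have hx : 0 ≤ t⁻¹ - 1 := sub_nonneg.2 ((one_le_inv₀ ht0).2 h1)
    have hl := Real.le_log_one_add_of_nonneg hx
    rw [add_sub_cancel, Real.log_inv] at hl
    have h2 : 2 * (t⁻¹ - 1) / (t⁻¹ - 1 + 2) = 2 * (1 - t) / (1 + t) := by
      field_simp
      ring
    have h3 : (1 - t) + (t - 1) ^ 2 / 2 ≤ 2 * (1 - t) / (1 + t) := by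
      rw [le_div_iff₀ (by linarith)]
      have : 0 ≤ (1 - t) ^ 3 := pow_nonneg (sub_nonneg.2 h1) 3
      nlinarith
    have h4 : (t - 1) ^ 2 / (2 * M) ≤ (t - 1) ^ 2 / 2 := by
      gcongr
      linarith
    linarith

variable {D : ℕ}

/-- The largest possible condition number of a covariance matrix with loss `l`. -/
noncomputable def lossCondBound (l : ℝ) : ℝ :=
  (1 + √(1 - Real.exp (-2 * l))) / (1 - √(1 - Real.exp (-2 * l)))

/-- Since `g ^ D = exp (-2 l)`, the dimension cancels; this is why `δ` can be chosen independently
of `D`. -/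
theorem condBound_geomMean (hD : 1 ≤ D) (l : ℝ) :
    condBound D (geomMean D l) = lossCondBound l := by
  have h : geomMean D l ^ D = Real.exp (-2 * l) := by
    rw [geomMean, ← Real.exp_nat_mul]
    congr 1
    field_simp
  rw [condBound, lossCondBound, h]

theorem sqrt_one_sub_exp_lt_one (l : ℝ) : √(1 - Real.exp (-2 * l)) < 1 := by
  rw [Real.sqrt_lt' one_pos]
  linarith [Real.exp_pos (-2 * l)]

theorem one_le_lossCondBound (l : ℝ) : 1 ≤ lossCondBound l := by
  rw [lossCondBound, le_div_iff₀ (sub_pos.2 (sqrt_one_sub_exp_lt_one l))]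
  linarith [Real.sqrt_nonneg (1 - Real.exp (-2 * l))]

theorem exists_lossCondBound_le {ε : ℝ} (hε : 0 < ε) :
    ∃ δ : ℝ, 0 < δ ∧ ∀ l : ℝ, 0 ≤ l → l ≤ δ → lossCondBound l ≤ 1 + ε := by
  have hc : ContinuousAt lossCondBound 0 := by
    unfold lossCondBound
    refine ContinuousAt.div (by fun_prop) (by fun_prop) ?_
    simp
  have h0 : lossCondBound 0 < 1 + ε := by simp [lossCondBound, hε]
  obtain ⟨δ, hδ, h⟩ := Metric.eventually_nhds_iff.1 (hc.eventually_lt continuousAt_const h0)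
  refine ⟨δ / 2, by positivity, fun l hl hlδ => (h ?_).le⟩
  rw [Real.dist_eq, sub_zero, abs_of_nonneg hl]
  linarith

theorem sub_one_sub_log_nonneg {t : ℝ} (ht : 0 < t) : 0 ≤ t - 1 - Real.log t := by
  linarith [Real.log_le_sub_one_of_pos ht]

/-- Two nonnegative terms of the loss, for `a` and `b`, already cost at least `-log (4ab / (a +
b)²)`. As `4ab / (a + b)² = 1 - ((a - b) / (a + b))²`, this bounds the relative gap `(a - b) / (a +
b)` by `√(1 - exp (-2 l))`. -/
theorem le_lossCondBound_mul {v : Fin D → ℝ} (hv : ∀ i, 0 < v i) {l : ℝ}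
    (hl : ∑ i, (v i - 1 - Real.log (v i)) = 2 * l) (i j : Fin D) :
    v i ≤ lossCondBound l * v j := by
  rcases eq_or_ne i j with rfl | hij
  · exact le_mul_of_one_le_left (hv i).le (one_le_lossCondBound l)
  set a := v i
  set b := v j
  have ha : 0 < a := hv i
  have hb : 0 < b := hv j
  have h1 : (a - 1 - Real.log a) + (b - 1 - Real.log b) ≤ 2 * l := by
    rw [← hl, ← Finset.sum_pair (f := fun k => v k - 1 - Real.log (v k)) hij]
    exact Finset.sum_le_sum_of_subset_of_nonneg (Finset.subset_univ _) fun k _ _ =>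
      sub_one_sub_log_nonneg (hv k)
  have h2 := Real.log_le_sub_one_of_pos (show 0 < (a + b) / 2 by positivity)
  have h3 : Real.exp (-2 * l) ≤ 4 * a * b / (a + b) ^ 2 := by
    rw [← Real.le_log_iff_exp_le (by positivity)]
    have e : 4 * a * b / (a + b) ^ 2 = a * b / ((a + b) / 2) ^ 2 := by
      field_simp
      ring
    rw [e, Real.log_div (by positivity) (by positivity), Real.log_mul ha.ne' hb.ne',
      Real.log_pow]
    push_cast
    linarith
  rw [le_div_iff₀ (by positivity)] at h3
  set s := √(1 - Real.exp (-2 * l)) with hs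
  have hs1 : 0 < 1 - s := sub_pos.2 (sqrt_one_sub_exp_lt_one l)
  have h4 : a - b ≤ s * (a + b) := by
    have h5 : (a - b) ^ 2 ≤ (1 - Real.exp (-2 * l)) * (a + b) ^ 2 := by nlinarith
    calc a - b ≤ √((a - b) ^ 2) := by
          rw [Real.sqrt_sq_eq_abs]
          exact le_abs_self _
      _ ≤ √((1 - Real.exp (-2 * l)) * (a + b) ^ 2) := Real.sqrt_le_sqrt h5
      _ = s * (a + b) := by
          rw [Real.sqrt_mul' _ (sq_nonneg _), Real.sqrt_sq (by positivity)]
  rw [lossCondBound, ← hs, div_mul_eq_mul_div, le_div_iff₀ hs1]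
  linarith

/-- The arithmetic mean exceeds the geometric mean by at least a multiple of the variance. -/
theorem sum_sq_le_one_sub_geomMean {v : Fin D → ℝ} (hD : 1 ≤ D) (hv : ∀ i, 0 < v i)
    (hsum : ∑ i, v i = D) {M : ℝ} (hM1 : 1 ≤ M) (hM : ∀ i, v i ≤ M) {l : ℝ}
    (hl : ∑ i, (v i - 1 - Real.log (v i)) = 2 * l) :
    ∑ i, (v i - 1) ^ 2 ≤ 2 * D * M ^ 2 * (1 - geomMean D l) := by
  have hD0 : (0 : ℝ) < D := by exact_mod_cast hD
  set V : ℝ := (∑ i, (v i - 1) ^ 2) / (D : ℝ) with hV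
  have hV0 : 0 ≤ V := by positivity
  have hVM : V ≤ M - 1 := by
    rw [hV, div_le_iff₀ hD0]
    -- This is `v i * (M - v i) ≥ 0`; averaging it with mean `1` gives `V ≤ M - 1`.
    have h1 : ∀ i, (v i - 1) ^ 2 ≤ (M - 2) * v i + 1 := fun i => by
      nlinarith [mul_nonneg (hv i).le (sub_nonneg.2 (hM i))]
    calc ∑ i, (v i - 1) ^ 2 ≤ ∑ i, ((M - 2) * v i + 1) := Finset.sum_le_sum fun i _ => h1 i
      _ = (M - 1) * D := by
        rw [Finset.sum_add_distrib, ← Finset.mul_sum, hsum]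
        simp
        ring
  have hlow : V / (2 * M) ≤ 2 * l / D := by
    rw [← hl, hV, div_div, mul_comm (D : ℝ), ← div_div]
    gcongr
    rw [Finset.sum_div]
    exact Finset.sum_le_sum fun i _ => le_sub_one_sub_log hM1 (hv i) (hM i)
  have hg : geomMean D l ≤ (1 + V / (2 * M))⁻¹ := by
    rw [geomMean, neg_mul, neg_div, Real.exp_neg]
    gcongr
    linarith [Real.add_one_le_exp (2 * l / D)]
  -- By `V ≤ M - 1`, `2M + V ≤ 2M²`, the difference being at least `(2M - 1)(M - 1) ≥ 0`.
  have h2 : V / (2 * M ^ 2) ≤ 1 - (1 + V / (2 * M))⁻¹ := by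
    have e : 1 - (1 + V / (2 * M))⁻¹ = V / (2 * M + V) := by
      field_simp
      ring
    rw [e]
    gcongr
    nlinarith
  have h3 : V ≤ 2 * M ^ 2 * (1 - geomMean D l) := by
    have h4 : V / (2 * M ^ 2) ≤ 1 - geomMean D l := by linarith
    rwa [div_le_iff₀ (by positivity), mul_comm] at h4
  calc ∑ i, (v i - 1) ^ 2 = (D : ℝ) * V := by
        rw [hV]
        field_simp
    _ ≤ D * (2 * M ^ 2 * (1 - geomMean D l)) := by gcongr
    _ = _ := by ring

end Estimates

/-! ### The expected loss after one block. -/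

section Step

open scoped Matrix

variable {D : ℕ}

theorem initialLoss_nonneg (S : Matrix (Fin D) (Fin D) ℝ) : 0 ≤ initialLoss S :=
  ENNReal.toReal_nonneg

theorem continuous_conj_apply (S : Matrix (Fin D) (Fin D) ℝ) (i j : Fin D) :
    Continuous fun Q : OD D => (Q.1 * S * Q.1ᵀ) i j :=
  ((continuous_subtype_val.matrix_mul continuous_const).matrix_mul
    continuous_subtype_val.matrix_transpose).matrix_elem i j

theorem initialLoss_nextCov_eq_sub {S : Matrix (Fin D) (Fin D) ℝ} (hS : IsNormalizedCov S)
    (Q : OD D) :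
    initialLoss (nextCov Q S) = initialLoss S -
      (∑ i, ((Q.1 * S * Q.1ᵀ) i i - 1 - Real.log ((Q.1 * S * Q.1ᵀ) i i))) / 2 := by
  have h : ∑ i, (Q.1 * S * Q.1ᵀ) i i = D := by
    rw [← hS.2, ← trace_conj Q S]
    rfl
  rw [initialLoss_nextCov hS, Finset.sum_sub_distrib, Finset.sum_sub_distrib, h]
  simp
  ring

theorem initialLoss_nextCov_le {S : Matrix (Fin D) (Fin D) ℝ} (hS : IsNormalizedCov S)
    (Q : OD D) : initialLoss (nextCov Q S) ≤ initialLoss S := by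
  rw [initialLoss_nextCov_eq_sub hS]
  have h := Finset.sum_nonneg fun i (_ : i ∈ Finset.univ) =>
    sub_one_sub_log_nonneg ((posDef_conj hS.1 Q).diag_pos (i := i))
  linarith

theorem continuous_initialLoss_nextCov {S : Matrix (Fin D) (Fin D) ℝ} (hS : IsNormalizedCov S) :
    Continuous fun Q : OD D => initialLoss (nextCov Q S) := by
  simp_rw [initialLoss_nextCov hS]
  refine continuous_const.add (Continuous.div_const (continuous_finsetSum _ fun i _ => ?_) _)
  exact (continuous_conj_apply S i i).log fun Q => (posDef_conj hS.1 Q).diag_pos.ne'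

/-- The expected loss after one block, with the spread of the eigenvalues of the covariance. -/
theorem exists_step_bounds {S : Matrix (Fin D) (Fin D) ℝ} (hD : 1 ≤ D) (hS : IsNormalizedCov S) :
    ∃ m M W : ℝ, 0 < m ∧ m ≤ 1 ∧ 1 ≤ M ∧ M ≤ lossCondBound (initialLoss S) * m ∧ 0 ≤ W ∧
      W ≤ 2 * D * M ^ 2 * (1 - geomMean D (initialLoss S)) ∧
      W / (4 * M) ≤ initialLoss S ∧ initialLoss S ≤ W / (4 * m) ∧
      ∫ Q, initialLoss (nextCov Q S) ∂haarOD D ≤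
        initialLoss S - 2 / ((D : ℝ) + 2) * (W / (4 * M)) ∧
      initialLoss S - 2 / ((D : ℝ) + 2) * (W / (4 * m)) ≤
        ∫ Q, initialLoss (nextCov Q S) ∂haarOD D := by
  obtain ⟨U, v, hv, hSU⟩ := exists_orthogonal_diagonalization hS.1
  have hne : (Finset.univ : Finset (Fin D)).Nonempty := ⟨⟨0, hD⟩, Finset.mem_univ _⟩
  obtain ⟨iM, -, hM⟩ := Finset.exists_max_image Finset.univ v hne
  obtain ⟨im, -, hm⟩ := Finset.exists_min_image Finset.univ v hne
  replace hM : ∀ i, v i ≤ v iM := fun i => hM i (Finset.mem_univ i)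
  replace hm : ∀ i, v im ≤ v i := fun i => hm i (Finset.mem_univ i)
  have hD0 : (0 : ℝ) < D := by exact_mod_cast hD
  have hsum : ∑ i, v i = D := by
    rw [← hS.2, hSU, trace_conj, Matrix.trace_diagonal]
  have hM1 : 1 ≤ v iM := by
    have h : ∑ i, v i ≤ ∑ _i : Fin D, v iM := Finset.sum_le_sum fun i _ => hM i
    rw [hsum, Finset.sum_const, Finset.card_univ, Fintype.card_fin, nsmul_eq_mul] at h
    exact le_of_mul_le_mul_left (by linarith) hD0
  have hm1 : v im ≤ 1 := by
    have h : ∑ _i : Fin D, v im ≤ ∑ i, v i := Finset.sum_le_sum fun i _ => hm i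
    rw [hsum, Finset.sum_const, Finset.card_univ, Fintype.card_fin, nsmul_eq_mul] at h
    exact le_of_mul_le_mul_left (by linarith) hD0
  have hl : ∑ i, (v i - 1 - Real.log (v i)) = 2 * initialLoss S := by
    have hdet : S.det = ∏ i, v i := by rw [hSU, det_conj, Matrix.det_diagonal]
    rw [initialLoss_eq hS, hdet, Real.log_prod fun i _ => (hv i).ne', Finset.sum_sub_distrib,
      Finset.sum_sub_distrib, hsum]
    simp
    ring
  have hdiag : ∀ (Q : OD D) (i : Fin D), (Q.1 * S * Q.1ᵀ) i i = ∑ j, (Q * U).1 i j ^ 2 * v j := by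
    intro Q i
    rw [hSU, conj_conj, conj_diagonal_apply_self]
  -- Each diagonal entry is a convex combination of eigenvalues, weighted by the squares of a unit
  -- row.
  have hAM : ∀ (Q : OD D) (i : Fin D), (Q.1 * S * Q.1ᵀ) i i ≤ v iM := by
    intro Q i
    rw [hdiag, ← one_mul (v iM), ← sum_sq_row (Q * U) i, Finset.sum_mul]
    exact Finset.sum_le_sum fun j _ => mul_le_mul_of_nonneg_left (hM j) (sq_nonneg _)
  have hAm : ∀ (Q : OD D) (i : Fin D), v im ≤ (Q.1 * S * Q.1ᵀ) i i := by
    intro Q i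
    rw [hdiag, ← one_mul (v im), ← sum_sq_row (Q * U) i, Finset.sum_mul]
    exact Finset.sum_le_sum fun j _ => mul_le_mul_of_nonneg_left (hm j) (sq_nonneg _)
  have hI := integral_sum_sq_diag U hsum
  rw [← hSU] at hI
  have hint : Integrable (fun Q : OD D => ∑ i, ((Q.1 * S * Q.1ᵀ) i i - 1) ^ 2) (haarOD D) :=
    integrable_of_continuous (continuous_finsetSum _ fun i _ =>
      ((continuous_conj_apply S i i).sub continuous_const).pow 2)
  have hint' : Integrable (fun Q : OD D => initialLoss (nextCov Q S)) (haarOD D) :=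
    integrable_of_continuous (continuous_initialLoss_nextCov hS)
  have hcomb : ∀ c : ℝ, ∫ Q : OD D, (initialLoss S -
      (∑ i, ((Q.1 * S * Q.1ᵀ) i i - 1) ^ 2) / (4 * c)) ∂haarOD D =
        initialLoss S - 2 / ((D : ℝ) + 2) * ((∑ i, (v i - 1) ^ 2) / (4 * c)) := by
    intro c
    rw [integral_sub (integrable_const _) (hint.div_const _), integral_div, hI, integral_const,
      probReal_univ, one_smul]
    ring
  -- The witnesses are the extreme eigenvalues and the total squared deviation. The quadratic bounds
  -- are applied to the eigenvalues for the loss, and to the diagonal entries for the gain.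
  refine ⟨v im, v iM, ∑ i, (v i - 1) ^ 2, hv im, hm1, hM1, le_lossCondBound_mul hv hl iM im,
    Finset.sum_nonneg fun i _ => sq_nonneg _, sum_sq_le_one_sub_geomMean hD hv hsum hM1 hM hl,
    ?_, ?_, ?_, ?_⟩
  · have h := Finset.sum_le_sum fun i (_ : i ∈ Finset.univ) =>
      le_sub_one_sub_log hM1 (hv i) (hM i)
    rw [hl, ← Finset.sum_div] at h
    have e : (∑ i, (v i - 1) ^ 2) / (4 * v iM) = (∑ i, (v i - 1) ^ 2) / (2 * v iM) / 2 := by ring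
    rw [e]
    linarith
  · have h := Finset.sum_le_sum fun i (_ : i ∈ Finset.univ) =>
      sub_one_sub_log_le (hv im) hm1 (hm i)
    rw [hl, ← Finset.sum_div] at h
    have e : (∑ i, (v i - 1) ^ 2) / (4 * v im) = (∑ i, (v i - 1) ^ 2) / (2 * v im) / 2 := by ring
    rw [e]
    linarith
  · rw [← hcomb]
    refine integral_mono hint' ((integrable_const _).sub (hint.div_const _)) fun Q => ?_
    have h := Finset.sum_le_sum fun i (_ : i ∈ Finset.univ) =>
      le_sub_one_sub_log hM1 ((posDef_conj hS.1 Q).diag_pos (i := i)) (hAM Q i)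
    rw [← Finset.sum_div] at h
    have e : (∑ i, ((Q.1 * S * Q.1ᵀ) i i - 1) ^ 2) / (4 * v iM) =
      (∑ i, ((Q.1 * S * Q.1ᵀ) i i - 1) ^ 2) / (2 * v iM) / 2 := by ring
    simp only [initialLoss_nextCov_eq_sub hS, e]
    linarith
  · rw [← hcomb]
    refine integral_mono ((integrable_const _).sub (hint.div_const _)) hint' fun Q => ?_
    have h := Finset.sum_le_sum fun i (_ : i ∈ Finset.univ) =>
      sub_one_sub_log_le (hv im) hm1 (hAm Q i)
    rw [← Finset.sum_div] at h
    have e : (∑ i, ((Q.1 * S * Q.1ᵀ) i i - 1) ^ 2) / (4 * v im) =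
      (∑ i, ((Q.1 * S * Q.1ᵀ) i i - 1) ^ 2) / (2 * v im) / 2 := by ring
    simp only [initialLoss_nextCov_eq_sub hS, e]
    linarith

/-- The same `W` controls the loss and the gain, so comparing them costs only the condition number
`M / m`. -/
theorem integral_initialLoss_nextCov_le {S : Matrix (Fin D) (Fin D) ℝ} (hD : 1 ≤ D)
    (hS : IsNormalizedCov S) :
    ∫ Q, initialLoss (nextCov Q S) ∂haarOD D ≤
      (1 - 2 / ((D : ℝ) + 2) / lossCondBound (initialLoss S)) * initialLoss S := by
  obtain ⟨m, M, W, hm, -, hM1, hMm, hW, -, -, hLm, hup, -⟩ := exists_step_bounds hD hS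
  have hK := one_le_lossCondBound (initialLoss S)
  have h : initialLoss S / lossCondBound (initialLoss S) ≤ W / (4 * M) := by
    rw [div_le_iff₀ (by linarith)]
    calc initialLoss S ≤ W / (4 * m) := hLm
      _ = W / (4 * (lossCondBound (initialLoss S) * m)) * lossCondBound (initialLoss S) := by
        field_simp
      _ ≤ _ := by gcongr
  calc _ ≤ _ := hup
    _ ≤ initialLoss S - 2 / ((D : ℝ) + 2) *
        (initialLoss S / lossCondBound (initialLoss S)) := by gcongr
    _ = _ := by ring

theorem le_integral_initialLoss_nextCov {S : Matrix (Fin D) (Fin D) ℝ} (hD : 1 ≤ D)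
    (hS : IsNormalizedCov S) :
    (1 - lossCondBound (initialLoss S) * (2 / ((D : ℝ) + 2))) * initialLoss S ≤
      ∫ Q, initialLoss (nextCov Q S) ∂haarOD D := by
  obtain ⟨m, M, W, hm, -, hM1, hMm, hW, -, hLM, -, -, hlow⟩ := exists_step_bounds hD hS
  have hK := one_le_lossCondBound (initialLoss S)
  have h : W / (4 * m) ≤ lossCondBound (initialLoss S) * initialLoss S := by
    calc W / (4 * m) = lossCondBound (initialLoss S) *
          (W / (4 * (lossCondBound (initialLoss S) * m))) := by field_simp
      _ ≤ lossCondBound (initialLoss S) * (W / (4 * M)) := by gcongr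
      _ ≤ _ := by gcongr
  calc _ = initialLoss S - 2 / ((D : ℝ) + 2) *
        (lossCondBound (initialLoss S) * initialLoss S) := by ring
    _ ≤ initialLoss S - 2 / ((D : ℝ) + 2) * (W / (4 * m)) := by gcongr
    _ ≤ _ := hlow

theorem le_integral_initialLoss_nextCov_of_condBound {S : Matrix (Fin D) (Fin D) ℝ} (hD : 1 ≤ D)
    (hS : IsNormalizedCov S) :
    initialLoss S - 2 / ((D : ℝ) + 2) * condBound D (geomMean D (initialLoss S)) ^ 2 *
        ((D : ℝ) / 2 * (1 - geomMean D (initialLoss S))) ≤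
      ∫ Q, initialLoss (nextCov Q S) ∂haarOD D := by
  obtain ⟨m, M, W, hm, hm1, hM1, hMm, hW, hWg, -, -, -, hlow⟩ := exists_step_bounds hD hS
  rw [condBound_geomMean hD]
  have hD0 : (0 : ℝ) < D := by exact_mod_cast hD
  set K := lossCondBound (initialLoss S)
  have hg : 0 ≤ 1 - geomMean D (initialLoss S) := by
    rw [geomMean, sub_nonneg, Real.exp_le_one_iff]
    exact div_nonpos_of_nonpos_of_nonneg (by linarith [initialLoss_nonneg S]) hD0.le
  -- Replacing `M` by `K * m` yields a factor `m ^ 2`: one `m` cancels the denominator, the other is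
  -- at most `1`.
  have h : W / (4 * m) ≤ K ^ 2 * ((D : ℝ) / 2 * (1 - geomMean D (initialLoss S))) := by
    rw [div_le_iff₀ (by positivity)]
    calc W ≤ 2 * D * M ^ 2 * (1 - geomMean D (initialLoss S)) := hWg
      _ ≤ 2 * D * (K * m) ^ 2 * (1 - geomMean D (initialLoss S)) := by gcongr
      _ = 2 * D * K ^ 2 * (1 - geomMean D (initialLoss S)) * m * m := by ring
      _ ≤ 2 * D * K ^ 2 * (1 - geomMean D (initialLoss S)) * m * 1 := by gcongr
      _ = _ := by ring
  calc _ = initialLoss S - 2 / ((D : ℝ) + 2) *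
        (K ^ 2 * ((D : ℝ) / 2 * (1 - geomMean D (initialLoss S)))) := by ring
    _ ≤ initialLoss S - 2 / ((D : ℝ) + 2) * (W / (4 * m)) := by gcongr
    _ ≤ _ := hlow

end Step

/-! ### Iteration over the blocks and the number of blocks needed. -/

section Iteration

open scoped Matrix

variable {D : ℕ}

instance instIsProbabilityMeasureHaarRotations (n : ℕ) :
    IsProbabilityMeasure (haarRotations D n) := by
  unfold haarRotations
  infer_instance

theorem lossAfter_zero (S : Matrix (Fin D) (Fin D) ℝ) (Q : Fin 0 → OD D) :
    lossAfter S 0 Q = initialLoss S := rfl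

theorem latent_succ_gaussianData {S : Matrix (Fin D) (Fin D) ℝ} (hS : S.PosDef) (n : ℕ)
    (Q : Fin (n + 1) → OD D) :
    latent (n + 1) Q (gaussianData S) =
      latent n (fun k => Q k.succ) (gaussianData (nextCov (Q 0) S)) := by
  rw [latent, block_gaussianData hS]

theorem lossAfter_succ {S : Matrix (Fin D) (Fin D) ℝ} (hS : S.PosDef) (n : ℕ)
    (Q : Fin (n + 1) → OD D) :
    lossAfter S (n + 1) Q = lossAfter (nextCov (Q 0) S) n fun k => Q k.succ := by
  rw [lossAfter, latent_succ_gaussianData hS, lossAfter]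

theorem loss_latent_ne_top (n : ℕ) {S : Matrix (Fin D) (Fin D) ℝ} (hS : S.PosDef)
    (Q : Fin n → OD D) : loss (latent n Q (gaussianData S)) ≠ ∞ := by
  induction n generalizing S with
  | zero => exact (loss_gaussianData hS).1
  | succ n ih =>
    rw [latent_succ_gaussianData hS]
    exact ih (isNormalizedCov_nextCov hS _).1 _

theorem continuous_nextCov {X : Type*} [TopologicalSpace X] {Q : X → OD D}
    {S : X → Matrix (Fin D) (Fin D) ℝ} (hQ : Continuous Q) (hS : Continuous S)
    (hpos : ∀ x, (S x).PosDef) : Continuous fun x => nextCov (Q x) (S x) := by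
  have hQ' : Continuous fun x => (Q x).1 := continuous_subtype_val.comp hQ
  have hA : Continuous fun x => (Q x).1 * S x * (Q x).1ᵀ :=
    (hQ'.matrix_mul hS).matrix_mul hQ'.matrix_transpose
  refine continuous_matrix fun i j => ?_
  simp_rw [nextCov, correlation_apply]
  have hs : ∀ i, Continuous fun x => (√(((Q x).1 * S x * (Q x).1ᵀ) i i))⁻¹ := fun i =>
    (hA.matrix_elem i i).sqrt.inv₀ fun x =>
      (Real.sqrt_pos.2 (posDef_conj (hpos x) (Q x)).diag_pos).ne'
  exact ((hs i).mul (hA.matrix_elem i j)).mul (hs j)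

/-- The covariance must vary too, since after one block it depends on the first rotation. On the
compact space of rotations, continuity yields integrability. -/
theorem continuous_lossAfter (n : ℕ) {X : Type*} [TopologicalSpace X] {Q : X → Fin n → OD D}
    {S : X → Matrix (Fin D) (Fin D) ℝ} (hQ : Continuous Q) (hS : Continuous S)
    (hnorm : ∀ x, IsNormalizedCov (S x)) : Continuous fun x => lossAfter (S x) n (Q x) := by
  induction n generalizing S with
  | zero =>
    simp_rw [lossAfter_zero, fun x => initialLoss_eq (hnorm x)]
    exact (hS.matrix_det.log fun x => (hnorm x).1.det_pos.ne').neg.div_const _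
  | succ n ih =>
    simp_rw [fun x => lossAfter_succ (hnorm x).1 n (Q x)]
    exact ih (continuous_pi fun k => (continuous_apply k.succ).comp hQ)
      (continuous_nextCov ((continuous_apply 0).comp hQ) hS fun x => (hnorm x).1)
      fun x => isNormalizedCov_nextCov (hnorm x).1 _

theorem integrable_lossAfter {S : Matrix (Fin D) (Fin D) ℝ} (hS : IsNormalizedCov S) (n : ℕ) :
    Integrable (lossAfter S n) (haarRotations D n) :=
  integrable_of_continuous (continuous_lossAfter n continuous_id continuous_const fun _ => hS)

theorem expectedLoss_nonneg (S : Matrix (Fin D) (Fin D) ℝ) (n : ℕ) : 0 ≤ expectedLoss S n :=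
  integral_nonneg fun _ => ENNReal.toReal_nonneg

theorem expectedLoss_zero (S : Matrix (Fin D) (Fin D) ℝ) : expectedLoss S 0 = initialLoss S := by
  simp [expectedLoss, lossAfter_zero]

theorem integrable_expectedLoss_nextCov {S : Matrix (Fin D) (Fin D) ℝ} (hS : IsNormalizedCov S)
    (n : ℕ) :
    Integrable (fun Q => expectedLoss (nextCov Q S) n) (haarOD D) ∧
      expectedLoss S (n + 1) = ∫ Q, expectedLoss (nextCov Q S) n ∂haarOD D := by
  have hint : Integrable (fun p : OD D × (Fin n → OD D) => lossAfter (nextCov p.1 S) n p.2)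
      ((haarOD D).prod (haarRotations D n)) :=
    integrable_of_continuous (continuous_lossAfter n continuous_snd
      (continuous_nextCov continuous_fst continuous_const fun _ => hS.1)
      fun _ => isNormalizedCov_nextCov hS.1 _)
  refine ⟨hint.integral_prod_left, ?_⟩
  -- Independence: the first rotation is split off, and Fubini integrates over the others first.
  have mp := measurePreserving_piFinSuccAbove (fun _ : Fin (n + 1) => haarOD D) 0
  have h := mp.integral_comp' fun p : OD D × (Fin n → OD D) => lossAfter (nextCov p.1 S) n p.2
  have hprod := integral_prod _ hint
  refine Eq.trans ?_ (h.trans hprod)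
  exact integral_congr_ae (.of_forall fun Q => lossAfter_succ hS.1 n Q)

theorem expectedLoss_succ {S : Matrix (Fin D) (Fin D) ℝ} (hS : IsNormalizedCov S) (n : ℕ) :
    expectedLoss S (n + 1) = ∫ Q, expectedLoss (nextCov Q S) n ∂haarOD D :=
  (integrable_expectedLoss_nextCov hS n).2

theorem expectedLoss_one {S : Matrix (Fin D) (Fin D) ℝ} (hS : IsNormalizedCov S) :
    expectedLoss S 1 = ∫ Q, initialLoss (nextCov Q S) ∂haarOD D := by
  rw [expectedLoss_succ hS]
  simp_rw [expectedLoss_zero]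

theorem integrable_initialLoss_nextCov {S : Matrix (Fin D) (Fin D) ℝ} (hS : IsNormalizedCov S) :
    Integrable (fun Q => initialLoss (nextCov Q S)) (haarOD D) :=
  integrable_of_continuous (continuous_initialLoss_nextCov hS)

/-- A block never increases the loss, so the region `initialLoss S ≤ δ`, where the one-step bound
holds, is never left. -/
theorem expectedLoss_le_pow_mul {a δ : ℝ} (ha : 0 ≤ a)
    (h : ∀ S : Matrix (Fin D) (Fin D) ℝ, IsNormalizedCov S → initialLoss S ≤ δ →
      ∫ Q, initialLoss (nextCov Q S) ∂haarOD D ≤ a * initialLoss S) (n : ℕ)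
    {S : Matrix (Fin D) (Fin D) ℝ} (hS : IsNormalizedCov S) (hδ : initialLoss S ≤ δ) :
    expectedLoss S n ≤ a ^ n * initialLoss S := by
  induction n generalizing S with
  | zero => simp [expectedLoss_zero]
  | succ n ih =>
    obtain ⟨hint, e⟩ := integrable_expectedLoss_nextCov hS n
    calc expectedLoss S (n + 1) = ∫ Q, expectedLoss (nextCov Q S) n ∂haarOD D := e
      _ ≤ ∫ Q, a ^ n * initialLoss (nextCov Q S) ∂haarOD D :=
        integral_mono hint ((integrable_initialLoss_nextCov hS).const_mul _) fun Q =>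
          ih (isNormalizedCov_nextCov hS.1 Q) ((initialLoss_nextCov_le hS Q).trans hδ)
      _ = a ^ n * ∫ Q, initialLoss (nextCov Q S) ∂haarOD D := integral_const_mul _ _
      _ ≤ a ^ n * (a * initialLoss S) := by
        gcongr
        exact h S hS hδ
      _ = _ := by ring

theorem pow_mul_le_expectedLoss {a δ : ℝ} (ha : 0 ≤ a)
    (h : ∀ S : Matrix (Fin D) (Fin D) ℝ, IsNormalizedCov S → initialLoss S ≤ δ →
      a * initialLoss S ≤ ∫ Q, initialLoss (nextCov Q S) ∂haarOD D) (n : ℕ)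
    {S : Matrix (Fin D) (Fin D) ℝ} (hS : IsNormalizedCov S) (hδ : initialLoss S ≤ δ) :
    a ^ n * initialLoss S ≤ expectedLoss S n := by
  induction n generalizing S with
  | zero => simp [expectedLoss_zero]
  | succ n ih =>
    obtain ⟨hint, e⟩ := integrable_expectedLoss_nextCov hS n
    calc a ^ (n + 1) * initialLoss S = a ^ n * (a * initialLoss S) := by ring
      _ ≤ a ^ n * ∫ Q, initialLoss (nextCov Q S) ∂haarOD D := by
        gcongr
        exact h S hS hδ
      _ = ∫ Q, a ^ n * initialLoss (nextCov Q S) ∂haarOD D := (integral_const_mul _ _).symm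
      _ ≤ ∫ Q, expectedLoss (nextCov Q S) n ∂haarOD D :=
        integral_mono ((integrable_initialLoss_nextCov hS).const_mul _) hint fun Q =>
          ih (isNormalizedCov_nextCov hS.1 Q) ((initialLoss_nextCov_le hS Q).trans hδ)
      _ = expectedLoss S (n + 1) := e.symm

theorem initialLoss_eq_zero_of_dim_one {S : Matrix (Fin 1) (Fin 1) ℝ} (hS : IsNormalizedCov S) :
    initialLoss S = 0 := by
  have h := hS.2
  rw [Matrix.trace_fin_one, Nat.cast_one] at h
  rw [initialLoss_eq hS, Matrix.det_fin_one, h]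
  simp

theorem two_le_of_initialLoss_pos (hD : 1 ≤ D) {S : Matrix (Fin D) (Fin D) ℝ}
    (hS : IsNormalizedCov S) (h : 0 < initialLoss S) : 2 ≤ D := by
  by_contra! hD'
  obtain rfl : D = 1 := by omega
  exact h.ne' (initialLoss_eq_zero_of_dim_one hS)

theorem two_div_add_two_le_half (hD : 2 ≤ D) : 2 / ((D : ℝ) + 2) ≤ 1 / 2 := by
  have : (2 : ℝ) ≤ D := by exact_mod_cast hD
  rw [div_le_div_iff₀ (by linarith) two_pos]
  linarith

/-- Each block multiplies the expected loss by approximately `1 - 2 / (D + 2)`. -/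
theorem exists_expectedLoss_bounds {ε : ℝ} (hε : 0 < ε) (hε1 : ε < 1) :
    ∃ δ : ℝ, 0 < δ ∧ ∀ (D : ℕ), 1 ≤ D → ∀ (S : Matrix (Fin D) (Fin D) ℝ), IsNormalizedCov S →
      initialLoss S ≤ δ → ∀ n : ℕ,
        (1 - (1 + ε) * (2 / ((D : ℝ) + 2))) ^ n * initialLoss S ≤ expectedLoss S n ∧
        expectedLoss S n ≤ (1 - (1 - ε) * (2 / ((D : ℝ) + 2))) ^ n * initialLoss S := by
  obtain ⟨δ, hδ, hK⟩ := exists_lossCondBound_le hε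
  refine ⟨δ, hδ, fun D hD S hS hSδ n => ?_⟩
  have hD1 : (1 : ℝ) ≤ D := by exact_mod_cast hD
  set x := 2 / ((D : ℝ) + 2) with hx
  have hx0 : 0 < x := by positivity
  have hx1 : x ≤ 1 := by
    rw [hx, div_le_one (by linarith)]
    linarith
  have hup : expectedLoss S n ≤ (1 - (1 - ε) * x) ^ n * initialLoss S := by
    refine expectedLoss_le_pow_mul (δ := δ) (by nlinarith) (fun S hS hSδ => ?_) n hS hSδ
    refine (integral_initialLoss_nextCov_le hD hS).trans ?_
    have h1 := one_le_lossCondBound (initialLoss S)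
    have h2 := hK _ (initialLoss_nonneg S) hSδ
    have h3 : (1 - ε) * x ≤ x / lossCondBound (initialLoss S) := by
      rw [le_div_iff₀ (by linarith)]
      -- `(1 - ε) (1 + ε) ≤ 1`.
      have : (1 - ε) * lossCondBound (initialLoss S) ≤ 1 := by nlinarith
      nlinarith
    exact mul_le_mul_of_nonneg_right (by linarith) (initialLoss_nonneg S)
  refine ⟨?_, hup⟩
  -- In dimension one the base `1 - (1 + ε) x` can be negative, but then the loss is zero. A
  -- positive loss forces `D ≥ 2`, hence `x ≤ 1 / 2` and a nonnegative base.
  rcases (initialLoss_nonneg S).eq_or_lt with h0 | h0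
  · rw [← h0, mul_zero]
    exact expectedLoss_nonneg S n
  have hx2 : x ≤ 1 / 2 := two_div_add_two_le_half (two_le_of_initialLoss_pos hD hS h0)
  refine pow_mul_le_expectedLoss (δ := δ) (by nlinarith) (fun S hS hSδ => ?_) n hS hSδ
  refine le_trans ?_ (le_integral_initialLoss_nextCov hD hS)
  refine mul_le_mul_of_nonneg_right ?_ (initialLoss_nonneg S)
  have h2 := hK _ (initialLoss_nonneg S) hSδ
  have := mul_le_mul_of_nonneg_right h2 hx0.le
  linarith

theorem exists_abs_expectedLoss_sub_le (n : ℕ) {ε : ℝ} (hε : 0 < ε) :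
    ∃ δ : ℝ, 0 < δ ∧ ∀ (D : ℕ), 1 ≤ D → ∀ (S : Matrix (Fin D) (Fin D) ℝ), IsNormalizedCov S →
      initialLoss S ≤ δ →
        |expectedLoss S n - rate D ^ n * initialLoss S| ≤ ε * (rate D ^ n * initialLoss S) := by
  obtain ⟨η, hη0, hη1, hηu, hηl⟩ : ∃ η : ℝ, 0 < η ∧ η < 1 ∧ (1 + η) ^ n ≤ 1 + ε ∧
      1 - ε ≤ (1 - η) ^ n := by
    have h1 : ∀ᶠ η : ℝ in nhds 0, (1 + η) ^ n < 1 + ε :=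
      ContinuousAt.eventually_lt (by fun_prop) continuousAt_const (by simp [hε])
    have h2 : ∀ᶠ η : ℝ in nhds 0, 1 - ε < (1 - η) ^ n :=
      ContinuousAt.eventually_lt continuousAt_const (by fun_prop) (by simp [hε])
    have h3 : ∀ᶠ η : ℝ in nhds 0, η < 1 := gt_mem_nhds one_pos
    obtain ⟨η, ⟨h1, h2, h3⟩, h4⟩ := (((h1.and (h2.and h3)).filter_mono
      (nhdsWithin_le_nhds (s := Set.Ioi 0))).and self_mem_nhdsWithin).exists
    exact ⟨η, h4, h3, h1.le, h2.le⟩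
  obtain ⟨δ, hδ, h⟩ := exists_expectedLoss_bounds hη0 hη1
  refine ⟨δ, hδ, fun D hD S hS hSδ => ?_⟩
  obtain ⟨hlow, hup⟩ := h D hD S hS hSδ n
  rcases (initialLoss_nonneg S).eq_or_lt with h0 | h0
  · rw [← h0, mul_zero] at hlow hup
    simp [← h0, le_antisymm hup hlow]
  have hx2 := two_div_add_two_le_half (two_le_of_initialLoss_pos hD hS h0)
  rw [rate]
  set x := 2 / ((D : ℝ) + 2) with hx
  have hx0 : 0 < x := by positivity
  -- Since `x ≤ 1 - x`, the error `η x` is at most `η (1 - x)`, a relative error; likewise in the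
  -- lower bound.
  have hu : (1 - (1 - η) * x) ^ n ≤ (1 + ε) * (1 - x) ^ n := by
    calc (1 - (1 - η) * x) ^ n ≤ ((1 + η) * (1 - x)) ^ n :=
          pow_le_pow_left₀ (by nlinarith) (by nlinarith) n
      _ = (1 + η) ^ n * (1 - x) ^ n := mul_pow _ _ _
      _ ≤ _ := mul_le_mul_of_nonneg_right hηu (pow_nonneg (by linarith) n)
  have hl : (1 - ε) * (1 - x) ^ n ≤ (1 - (1 + η) * x) ^ n := by
    calc (1 - ε) * (1 - x) ^ n ≤ (1 - η) ^ n * (1 - x) ^ n :=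
          mul_le_mul_of_nonneg_right hηl (pow_nonneg (by linarith) n)
      _ = ((1 - η) * (1 - x)) ^ n := (mul_pow _ _ _).symm
      _ ≤ _ := pow_le_pow_left₀ (mul_nonneg (by linarith) (by linarith)) (by nlinarith) n
  have hu' := mul_le_mul_of_nonneg_right hu h0.le
  have hl' := mul_le_mul_of_nonneg_right hl h0.le
  rw [abs_le]
  constructor <;> linarith

/-- Perturbing the rate by `ε / 4` adds `log r` to `-log (1 - x)`. The denominator of `r` is at
least `1 / 4`, so `log r ≤ ε x ≤ -ε log (1 - x)`, and `(1 - ε) (1 + ε) ≤ 1` concludes. -/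
theorem neg_log_one_sub_mul_le {ε x : ℝ} (hε : 0 < ε) (hε1 : ε < 1) (hx : 0 < x)
    (hx2 : x ≤ 1 / 2) :
    (1 - ε) * -Real.log (1 - (1 + ε / 4) * x) ≤ -Real.log (1 - x) := by
  have hpos : 0 < 1 - x := by linarith
  have hpos' : 0 < 1 - (1 + ε / 4) * x := by nlinarith
  set r := (1 - x) / (1 - (1 + ε / 4) * x) with hr
  have hr0 : 0 < r := by positivity
  have h1 : -Real.log (1 - (1 + ε / 4) * x) = -Real.log (1 - x) + Real.log r := by
    rw [hr, Real.log_div hpos.ne' hpos'.ne']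
    ring
  have h2 : Real.log r ≤ ε * x := by
    refine (Real.log_le_sub_one_of_pos hr0).trans ?_
    have : r - 1 = ε / 4 * x / (1 - (1 + ε / 4) * x) := by
      rw [hr, div_sub_one hpos'.ne']
      ring
    rw [this, div_le_iff₀ hpos']
    have : 1 / 4 ≤ 1 - (1 + ε / 4) * x := by nlinarith
    nlinarith [mul_pos hε hx]
  have h3 : x ≤ -Real.log (1 - x) := by
    linarith [Real.log_le_sub_one_of_pos hpos]
  rw [h1]
  nlinarith [mul_pos hε hx]

theorem exists_le_number_of_blocks {ε : ℝ} (hε : 0 < ε) (hε1 : ε < 1) :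
    ∃ δ : ℝ, 0 < δ ∧ ∀ (D : ℕ), 1 ≤ D → ∀ (S : Matrix (Fin D) (Fin D) ℝ), IsNormalizedCov S →
      0 < initialLoss S → initialLoss S ≤ δ → ∀ (n : ℕ) (l : ℝ), 0 < l → expectedLoss S n ≤ l →
        (1 - ε) * (Real.log (l / initialLoss S) / Real.log (rate D)) ≤ n := by
  obtain ⟨δ, hδ, h⟩ := exists_expectedLoss_bounds (ε := ε / 4) (by linarith) (by linarith)
  refine ⟨δ, hδ, fun D hD S hS h0 hSδ n l hl hnl => ?_⟩
  have hx2 := two_div_add_two_le_half (two_le_of_initialLoss_pos hD hS h0)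
  have hlow := ((h D hD S hS hSδ n).1).trans hnl
  rw [rate]
  set x := 2 / ((D : ℝ) + 2) with hx
  have hx0 : 0 < x := by positivity
  have hpos' : 0 < 1 - (1 + ε / 4) * x := by nlinarith
  have hlog : Real.log (1 - x) < 0 := Real.log_neg (by linarith) (by linarith)
  have hlog' : n * Real.log (1 - (1 + ε / 4) * x) ≤ Real.log (l / initialLoss S) := by
    rw [← Real.log_pow]
    exact Real.log_le_log (by positivity) ((le_div_iff₀ h0).2 hlow)
  have hcmp := neg_log_one_sub_mul_le hε hε1 hx0 hx2
  rw [← mul_div_assoc, div_le_iff_of_neg hlog]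
  have h1 := mul_le_mul_of_nonneg_left hcmp n.cast_nonneg
  have h2 := mul_le_mul_of_nonneg_left hlog' (sub_nonneg.2 hε1.le)
  linarith

theorem exists_mul_dim_le_number_of_blocks {r : ℝ} (hr : 0 < r) (hr1 : r < 1) :
    ∃ δ c : ℝ, 0 < δ ∧ 0 < c ∧
      ∀ (D : ℕ), 1 ≤ D → ∀ (S : Matrix (Fin D) (Fin D) ℝ), IsNormalizedCov S →
        0 < initialLoss S → initialLoss S ≤ δ → ∀ n : ℕ, expectedLoss S n ≤ r * initialLoss S →
          c * D ≤ n := by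
  obtain ⟨δ, hδ, h⟩ := exists_le_number_of_blocks (ε := 1 / 2) (by norm_num) (by norm_num)
  have hlr : Real.log r < 0 := Real.log_neg hr hr1
  -- One factor `1 / 2` is `1 - ε`; the other comes from `-log (rate D) = log (1 + 2 / D) ≤ 2 / D`.
  refine ⟨δ, -Real.log r / 4, hδ, by linarith, fun D hD S hS h0 hSδ n hn => ?_⟩
  have h1 := h D hD S hS h0 hSδ n _ (by positivity) hn
  rw [mul_div_cancel_right₀ _ h0.ne'] at h1
  refine le_trans ?_ h1
  have hD0 : (0 : ℝ) < D := by exact_mod_cast hD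
  have e : rate D = (1 + 2 / (D : ℝ))⁻¹ := by
    rw [rate]
    field_simp
    ring
  have hpos : 0 < Real.log (1 + 2 / (D : ℝ)) := Real.log_pos (by linarith [div_pos two_pos hD0])
  have hle : Real.log (1 + 2 / (D : ℝ)) ≤ 2 / D := by
    linarith [Real.log_le_sub_one_of_pos (show 0 < 1 + 2 / (D : ℝ) by positivity)]
  have h2 : -Real.log r * D / 2 ≤ -Real.log r / Real.log (1 + 2 / (D : ℝ)) := by
    rw [le_div_iff₀ hpos]
    calc -Real.log r * D / 2 * Real.log (1 + 2 / (D : ℝ)) ≤ -Real.log r * D / 2 * (2 / D) := by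
          refine mul_le_mul_of_nonneg_left hle (div_nonneg (mul_nonneg ?_ hD0.le) two_pos.le)
          linarith
      _ = -Real.log r := by field_simp
  rw [e, Real.log_inv, div_neg, ← neg_div]
  linarith

end Iteration

end Gaussianization

open Gaussianization in
theorem theorem2 :
    -- the losses are finite, and their expectations exist
    (∀ (D : ℕ), 1 ≤ D → ∀ (S : Matrix (Fin D) (Fin D) ℝ), IsNormalizedCov S → ∀ n : ℕ,
      (∀ Q : Fin n → OD D, loss (latent n Q (gaussianData S)) ≠ ⊤) ∧
      Integrable (lossAfter S n) (haarRotations D n)) ∧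
    -- low-loss asymptotics: for every number `n` of blocks, the expected loss is
    -- `(1 - 2 / (D + 2)) ^ n` times the initial loss, up to a relative error that tends to `0`
    -- with the initial loss, uniformly in `D` and the covariance
    (∀ (n : ℕ) (ε : ℝ), 0 < ε → ∃ δ : ℝ, 0 < δ ∧
      ∀ (D : ℕ), 1 ≤ D → ∀ (S : Matrix (Fin D) (Fin D) ℝ), IsNormalizedCov S →
        initialLoss S ≤ δ →
          |expectedLoss S n - rate D ^ n * initialLoss S| ≤ ε * (rate D ^ n * initialLoss S)) ∧
    -- uniformly in the number of blocks, each of them multiplies the expected loss by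
    -- approximately `1 - 2 / (D + 2)`
    (∀ ε : ℝ, 0 < ε → ε < 1 → ∃ δ : ℝ, 0 < δ ∧
      ∀ (D : ℕ), 1 ≤ D → ∀ (S : Matrix (Fin D) (Fin D) ℝ), IsNormalizedCov S →
        initialLoss S ≤ δ → ∀ n : ℕ,
          (1 - (1 + ε) * (2 / ((D : ℝ) + 2))) ^ n * initialLoss S ≤ expectedLoss S n ∧
          expectedLoss S n ≤ (1 - (1 - ε) * (2 / ((D : ℝ) + 2))) ^ n * initialLoss S) ∧
    -- lower bound for a single block, at any loss
    (∀ (D : ℕ), 1 ≤ D → ∀ (S : Matrix (Fin D) (Fin D) ℝ), IsNormalizedCov S →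
      initialLoss S - 2 / ((D : ℝ) + 2) * condBound D (geomMean D (initialLoss S)) ^ 2 *
          ((D : ℝ) / 2 * (1 - geomMean D (initialLoss S))) ≤ expectedLoss S 1) ∧
    -- number of layers needed to reach the expected loss `l`
    (∀ ε : ℝ, 0 < ε → ε < 1 → ∃ δ : ℝ, 0 < δ ∧
      ∀ (D : ℕ), 1 ≤ D → ∀ (S : Matrix (Fin D) (Fin D) ℝ), IsNormalizedCov S →
        0 < initialLoss S → initialLoss S ≤ δ → ∀ (n : ℕ) (l : ℝ), 0 < l → expectedLoss S n ≤ l →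
          (1 - ε) * (Real.log (l / initialLoss S) / Real.log (rate D)) ≤ n) ∧
    -- the number of layers needed to cut the loss by a fixed factor is `Ω(D)`
    (∀ r : ℝ, 0 < r → r < 1 → ∃ δ c : ℝ, 0 < δ ∧ 0 < c ∧
      ∀ (D : ℕ), 1 ≤ D → ∀ (S : Matrix (Fin D) (Fin D) ℝ), IsNormalizedCov S →
        0 < initialLoss S → initialLoss S ≤ δ → ∀ n : ℕ, expectedLoss S n ≤ r * initialLoss S →
          c * D ≤ n) := by
  refine ⟨fun D _ S hS n => ⟨loss_latent_ne_top n hS.1, integrable_lossAfter hS n⟩,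
    fun n ε hε => exists_abs_expectedLoss_sub_le n hε,
    fun ε hε hε1 => exists_expectedLoss_bounds hε hε1, fun D hD S hS => ?_,
    fun ε hε hε1 => exists_le_number_of_blocks hε hε1,
    fun r hr hr1 => exists_mul_dim_le_number_of_blocks hr hr1⟩
  rw [expectedLoss_one hS]
  exact le_integral_initialLoss_nextCov_of_condBound hD hS
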